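/- Let $f(z)=\lambda e^z$, $\lambda\in\mathbb C\setminus\{0\}$, have an attracting periodic cycle $z_0,\dots,z_{p-1},z_p=z_0$ of exact period $p>1$, where $z_j=f^j(z_0)$. Let $U_j$ be the component of the basin of attraction of this cycle that contains $z_j$, labelled so that $0\in U_1$; let $J(f)$ be the Julia set of $f$. Let $B\subset U_1$ be a simply connected domain with $0,z_1\in B$, whose boundary is a Jordan curve in $U_1$ and for which $\overline{f^p(B)}\subset B$. For a sufficiently large $L_1$ (depending on $B$), let $C_p\subset f^{-1}(B)$ be any domain containing $z_0$ and a left half-plane, such that $\partial C_p$ is a curve homeomorphic to $\mathbb R$ whose two ends have imaginary parts tending to $+\infty$ and $-\infty$, $\partial C_p$ coincides with $\partial f^{-1}(B)$ on $\{|\mathrm{Im}\, z|<L_1\}$, and for some $L_2>0$ the part of $\partial C_p$ in each of $\{\mathrm{Im}\, z>L_2\}$ and $\{\mathrm{Im}\, z<-L_2\}$ is a vertical half-line. For $j=p-1,\dots,0$ let $C_j$ be the component of $f^{-1}(C_{j+1})$ that contains $z_j$. Choose any component $\mathcal H_0$ of $\mathbb C\setminus C_0$ and let $\mathcal H_s$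 be the component of $\mathbb C\setminus C_0$ containing $w+2\pi i s$, where $w\in\mathcal H_0$ $(s\in\mathbb Z)$, so that $\mathcal H_s=\mathcal H_0+2\pi i s$. An itinerary of $z$ is a sequence $(\sigma_0,\sigma_1,\dots)$ of integers with $f^n(z)\in\mathcal H_{\sigma_n}$ for all $n\ge0$. Then every $z\in J(f)$ has exactly one itinerary; there is exactly one block $\underline k=(k_1,\dots,k_{p-1})$ of integers with $z_j\in C_j\subset U_j\subset\mathcal H_{k_j}$ for $j=1,\dots,p-1$; and, with $$\Sigma_{\underline k}=\{(s_0,\underline k,s_1,\underline k,\dots): s_0,s_1,\ldots\in\mathbb Z\},$$ $$\Sigma'_{\underline k}=\{(s_0,\underline k,s_1,\underline k,\dots)\in\Sigma_{\underline k}: s_n\notin\{k_1,\dots,k_{p-1}\}\text{ for infinitely many } n\},$$ we have $$\{z\in J(f): z\text{ has itinerary in }\Sigma'_{\underline k}\}\subset\partial U_0\subset\{z\in J(f): z\text{ has itinerary in }\Sigma_{\underline k}\}.$$ -/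

import Mathlib

open Set Filter Topology

noncomputable section

/-- The exponential map `z ↦ lam * exp z`. -/
def expMap (lam : ℂ) (z : ℂ) : ℂ := lam * Complex.exp z

/-- The iterates of `f` form a normal family on `V`: every sequence of iterates has a subsequence
which, locally uniformly on `V`, converges to a finite function or tends to `∞`. -/
def IteratesNormalOn (f : ℂ → ℂ) (V : Set ℂ) : Prop :=
  ∀ n : ℕ → ℕ, ∃ φ : ℕ → ℕ, StrictMono φ ∧
    ((∃ g : ℂ → ℂ, TendstoLocallyUniformlyOn (fun m => f^[n (φ m)]) g atTop V) ∨
      (∀ K : Set ℂ, K ⊆ V → IsCompact K → ∀ R : ℝ, ∀ᶠ m in atTop, ∀ z ∈ K,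
        R < ‖f^[n (φ m)] z‖))

/-- The Fatou set: the points having a disc around them on which the iterates are normal. -/
def fatouSet (f : ℂ → ℂ) : Set ℂ :=
  {z | ∃ r : ℝ, 0 < r ∧ IteratesNormalOn f (Metric.ball z r)}

/-- The Julia set. -/
def juliaSet (f : ℂ → ℂ) : Set ℂ := (fatouSet f)ᶜ

/-- `z₀` lies on an attracting cycle of exact period `p`. -/
def IsAttractingPeriodicPt (f : ℂ → ℂ) (p : ℕ) (z₀ : ℂ) : Prop :=
  0 < p ∧ Function.minimalPeriod f z₀ = p ∧ ‖deriv (f^[p]) z₀‖ < 1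

/-- The (entire) basin of attraction of the cycle `z₀, f z₀, …, f^{p-1} z₀`. -/
def cycleBasin (f : ℂ → ℂ) (p : ℕ) (z₀ : ℂ) : Set ℂ :=
  {z | ∃ j < p, Tendsto (fun n : ℕ => f^[n * p] z) atTop (𝓝 (f^[j] z₀))}

/-- `U_j`: the component of the basin which contains `z_j = f^j z₀`. -/
def basinComponent (f : ℂ → ℂ) (p : ℕ) (z₀ : ℂ) (j : ℕ) : Set ℂ :=
  connectedComponentIn (cycleBasin f p z₀) (f^[j] z₀)

/-- The conditions on the domain `B = B_{p+1} ⊆ U_1`: it is a simply connected domain bounded by a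
Jordan curve in `U_1`, it contains `0` and `z_1`, and `f^p` maps it strictly into itself. -/
structure IsAbsorbingDomain (f : ℂ → ℂ) (p : ℕ) (z₀ : ℂ) (B : Set ℂ) : Prop where
  isOpen : IsOpen B
  simplyConnected : IsSimplyConnected B
  subset : B ⊆ basinComponent f p z₀ 1
  zero_mem : (0 : ℂ) ∈ B
  cycle_mem : f z₀ ∈ B
  frontier_jordan : ∃ γ : Circle → ℂ, IsEmbedding γ ∧ range γ = frontier B
  frontier_subset : frontier B ⊆ basinComponent f p z₀ 1
  maps_into : closure (f^[p] '' B) ⊆ B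

/-- The conditions on the domain `C = C_p ⊆ B_p = f⁻¹(B)`: it contains `z_0` and a left half-plane,
its boundary is a curve homeomorphic to the line whose ends have imaginary parts tending to
`±∞`, the boundary agrees with that of `B_p` on `|Im z| < L₁`, and it is vertical on
`|Im z| > L₂` for some `L₂ > 0`. -/
structure IsTruncatedDomain (f : ℂ → ℂ) (z₀ : ℂ) (B : Set ℂ) (L₁ : ℝ) (C : Set ℂ) : Prop where
  isOpen : IsOpen C
  isConnected : IsConnected C
  subset : C ⊆ f ⁻¹' B
  cycle_mem : z₀ ∈ C
  halfPlane : ∃ c : ℝ, {z : ℂ | z.re < c} ⊆ C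
  frontier_line : ∃ Γ : ℝ → ℂ, IsEmbedding Γ ∧ range Γ = frontier C ∧
    Tendsto (fun t => (Γ t).im) atTop atTop ∧ Tendsto (fun t => (Γ t).im) atBot atBot
  frontier_eq : ∀ z : ℂ, |z.im| < L₁ → (z ∈ frontier C ↔ z ∈ frontier (f ⁻¹' B))
  frontier_vertical : ∃ L₂ : ℝ, 0 < L₂ ∧
    (∃ a : ℝ, ∀ z : ℂ, L₂ < z.im → (z ∈ frontier C ↔ z.re = a)) ∧
    (∃ b : ℝ, ∀ z : ℂ, z.im < -L₂ → (z ∈ frontier C ↔ z.re = b))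

/-- `pulledBackDomain f p z₀ C m` is `C_{p-m}`: it is `C` for `m = 0`, and each next one is the
component of the preimage of the previous one which contains the corresponding cycle point. -/
def pulledBackDomain (f : ℂ → ℂ) (p : ℕ) (z₀ : ℂ) (C : Set ℂ) : ℕ → Set ℂ
  | 0 => C
  | m + 1 => connectedComponentIn (f ⁻¹' pulledBackDomain f p z₀ C m) (f^[p - (m + 1)] z₀)

/-- The domain `C_j`, `0 ≤ j ≤ p`, obtained from `C_p = C`. -/
def cycleDomain (f : ℂ → ℂ) (p : ℕ) (z₀ : ℂ) (C : Set ℂ) (j : ℕ) : Set ℂ :=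
  pulledBackDomain f p z₀ C (p - j)

/-- The piece `H_s`: the component of `ℂ ∖ C_0` which contains `w + 2πis`.  Here `w ∉ C_0` is a
base point, whose choice amounts to the choice of the component that gets the label `0`. -/
def piece (C₀ : Set ℂ) (w : ℂ) (s : ℤ) : Set ℂ :=
  connectedComponentIn C₀ᶜ (w + 2 * Real.pi * Complex.I * (s : ℂ))

/-- `σ` is an itinerary of `z` with respect to the pieces `H_s`. -/
def HasItinerary (f : ℂ → ℂ) (H : ℤ → Set ℂ) (z : ℂ) (σ : ℕ → ℤ) : Prop :=
  ∀ n : ℕ, f^[n] z ∈ H (σ n)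

/-- `(k_1, …, k_{p-1})` is the kneading block: `z_j ∈ C_j ⊆ U_j ⊆ H_{k_j}` for `1 ≤ j ≤ p - 1`;
the entry with index `i : Fin (p - 1)` is `k_{i+1}`. -/
def IsKneadingBlock (f : ℂ → ℂ) (p : ℕ) (z₀ : ℂ) (C : Set ℂ) (H : ℤ → Set ℂ)
    (k : Fin (p - 1) → ℤ) : Prop :=
  ∀ i : Fin (p - 1),
    f^[(i : ℕ) + 1] z₀ ∈ cycleDomain f p z₀ C (i + 1) ∧
    cycleDomain f p z₀ C (i + 1) ⊆ basinComponent f p z₀ (i + 1) ∧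
    basinComponent f p z₀ (i + 1) ⊆ H (k i)

/-- `Σ_k`: the sequences `(s_0, k, s_1, k, …)`, where `s_l` stands in position `p * l`. -/
def kneadingSequences (p : ℕ) (k : Fin (p - 1) → ℤ) : Set (ℕ → ℤ) :=
  {σ | ∀ (l : ℕ) (i : Fin (p - 1)), σ (p * l + ((i : ℕ) + 1)) = k i}

/-- `Σ'_k`: the sequences `(s_0, k, s_1, k, …)` such that `s_l` is not an entry of `k` for
infinitely many `l`. -/
def kneadingSequences' (p : ℕ) (k : Fin (p - 1) → ℤ) : Set (ℕ → ℤ) :=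
  {σ | σ ∈ kneadingSequences p k ∧ ∃ᶠ l in atTop, σ (p * l) ∉ range k}

end

/-! Write `f` for the exponential map. Since the singular value 0 lies in `U_1`, the preimage of
`U_1` is connected and equals `U_0`. For `1 ≤ j < p`, in contrast, `f` is injective on `U_j` and has
an inverse `U_{j+1} → U_j` (`exists_inverse_basinComponent`). Otherwise an arc in `U_j` would join
two points differing by a nonzero multiple of `2πi`; its image would be a closed curve in `U_{j+1}`
separating 0 from `∞` (`isBounded_of_disjoint_expMap_path`), and the maximum principle would put 0
into the wrong attracted set (`mem_attractedSet_of_isBounded`).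

For large `L₁` the set `f^{p-1}(closure B)` lies in `C_p`, so `0 ∈ B ⊆ C_1` and `C_0` is the whole
preimage of `C_1`. Pulling back along the inverse branches shows that `C_1` contains a closed
connected set from 0 to `∞` and has connected complement (`cycleDomain_geometry`). Hence `f` has
inverse branches on the complement of `C_1`, and their images are the pieces: they are translates of
one another, and no piece contains two points differing by a nonzero multiple of `2πi`. Julia points
avoid `C_0`, which gives the itineraries; each `U_j` with `1 ≤ j < p` is connected and avoids `C_0`,
which gives the block.

The outer inclusion holds because the orbit of a boundary point of `U_0` runs through the closures
of the `U_j`, while the pieces are closed.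

For the inner inclusion (`mem_closure_of_hasItinerary`), let `s_l` avoid the block, and put `n = p *
l`. From `ζ = f^n(z)` go vertically to the first point `e` of the closure of `C_0`, which lies in
`U_0`. This segment has a definite distance from a compact forward invariant set `P` containing 0,
so the branch `φ` of `f^{-n}` with `φ(ζ) = z` extends along it. The itinerary forces `φ(e) ∈ U_0`.
As `n → ∞`, `φ(e)` tends to `z`, since `φ` omits `P` and also points arbitrarily near `z` that `f^n`
sends into `P` (`inverse_branch_shrinks`). All omitted sets contain a disc, so normality reduces to
bounded functions and Harnack's inequality. -/

/-! ### Harnack's inequality, Montel's theorem and a normality criterion -/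

/-- A nonvanishing holomorphic function on a disc has a holomorphic logarithm. -/
theorem exists_differentiableOn_exp_eq_of_ball {a : ℂ} {R : ℝ} {g : ℂ → ℂ}
    (hg : DifferentiableOn ℂ g (Metric.ball a R)) (h0 : ∀ z ∈ Metric.ball a R, g z ≠ 0) :
    ∃ q : ℂ → ℂ, DifferentiableOn ℂ q (Metric.ball a R) ∧
      ∀ z ∈ Metric.ball a R, Complex.exp (q z) = g z := by
  rcases le_or_gt R 0 with hR | hR
  · exact ⟨0, by simp [Metric.ball_eq_empty.2 hR], by simp [Metric.ball_eq_empty.2 hR]⟩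
  have hsc : IsSimplyConnected (Metric.ball a R) := by
    have := Metric.contractibleSpace_ball (x := a) hR
    exact (inferInstance : SimplyConnectedSpace (Metric.ball a R))
  obtain ⟨q, hqc, hq⟩ := Complex.exists_continuousOn_eqOn_exp_comp hsc Metric.isOpen_ball
    hg.continuousOn (by rintro ⟨z, hz, h⟩; exact h0 z hz h)
  -- By continuity, near `z` the function `q` is a local inverse of the exponential composed with
  -- `g`, hence differentiable.
  refine ⟨q, fun z hz => ?_, hq⟩
  have hc : ContinuousAt q z := hqc.continuousAt (Metric.isOpen_ball.mem_nhds hz)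
  have hgz : DifferentiableAt ℂ g z := hg.differentiableAt (Metric.isOpen_ball.mem_nhds hz)
  have hd := (Complex.hasStrictDerivAt_exp (q z)).to_localInverse (Complex.exp_ne_zero _)
  set l := (Complex.hasStrictDerivAt_exp (q z)).localInverse Complex.exp _ _ (Complex.exp_ne_zero _)
  have hli : ∀ᶠ x in 𝓝 (q z), l (Complex.exp x) = x :=
    HasStrictFDerivAt.eventually_left_inverse _
  have hqz := hq hz
  simp only [Function.comp_apply] at hqz
  have h1 : DifferentiableAt ℂ (l ∘ g) z := by
    refine DifferentiableAt.comp z ?_ hgz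
    rw [← hqz]; exact hd.hasDerivAt.differentiableAt
  refine (h1.congr_of_eventuallyEq ?_).differentiableWithinAt
  filter_upwards [hc.eventually hli, Metric.isOpen_ball.mem_nhds hz] with w hw hwb
  have := hq hwb
  simp only [Function.comp_apply] at this ⊢
  rw [← this, hw]

/-- Harnack's inequality, for the modulus of a bounded nonvanishing holomorphic function. -/
theorem norm_pow_three_le_of_ne_zero {a b : ℂ} {R M : ℝ} {g : ℂ → ℂ}
    (hg : DifferentiableOn ℂ g (Metric.ball a R)) (h0 : ∀ z ∈ Metric.ball a R, g z ≠ 0)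
    (hM : ∀ z ∈ Metric.ball a R, ‖g z‖ < M) (hb : b ∈ Metric.ball a (R / 2)) :
    ‖g b‖ ^ 3 ≤ M ^ 2 * ‖g a‖ ∧ ‖g a‖ ^ 3 ≤ M ^ 2 * ‖g b‖ := by
  have hR : 0 < R := by
    have := (Metric.nonempty_ball.1 ⟨b, hb⟩); linarith
  have ha : a ∈ Metric.ball a R := Metric.mem_ball_self hR
  have hbR : b ∈ Metric.ball a R := Metric.ball_subset_ball (by linarith) hb
  have hMpos : 0 < M := (norm_nonneg _).trans_lt (hM a ha)
  obtain ⟨q, hqd, hq⟩ := exists_differentiableOn_exp_eq_of_ball hg h0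
  set Q : ℂ → ℂ := fun z => (Real.log M : ℂ) - q z with hQ
  have hQd : DifferentiableOn ℂ Q (Metric.ball a R) := by
    exact (differentiableOn_const _).sub hqd
  have hn : ∀ z ∈ Metric.ball a R, ‖g z‖ = M * Real.exp (-(Q z).re) := by
    intro z hz
    rw [← hq z hz, Complex.norm_exp]
    simp only [hQ, Complex.sub_re, Complex.ofReal_re, neg_sub, Real.exp_sub, Real.exp_log hMpos]
    field_simp
  have hpos : ∀ z ∈ Metric.ball a R, 0 < (Q z).re := by
    intro z hz
    have h1 := hM z hz
    rw [hn z hz] at h1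
    have h2 : Real.exp (-(Q z).re) < 1 := by
      by_contra h; push Not at h; nlinarith
    have := Real.exp_lt_one_iff.1 h2
    linarith
  set c := (Q a).re with hc
  have hcpos : 0 < c := hpos a ha
  -- normalised to have real value at the centre
  set Y : ℂ → ℂ := fun z => Q z - Complex.I * (Q a).im with hY
  have hYa : Y a = c := by
    apply Complex.ext <;> simp [hY, hc]
  have hYre : ∀ z, (Y z).re = (Q z).re := by intro z; simp [hY]
  have hden : ∀ z ∈ Metric.ball a R, Y z + c ≠ 0 := by
    intro z hz h
    have := congrArg Complex.re h
    simp [hYre] at this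
    linarith [hpos z hz]
  -- This Cayley transform sends the right half-plane into the unit disc and `c` to 0, so the
  -- Schwarz lemma bounds it by 1/2 on the half-size disc.
  set T : ℂ → ℂ := fun z => (Y z - c) / (Y z + c) with hT
  have hTd : DifferentiableOn ℂ T (Metric.ball a R) := by
    have hYd : DifferentiableOn ℂ Y (Metric.ball a R) := hQd.sub (differentiableOn_const _)
    exact (hYd.sub (differentiableOn_const _)).div (hYd.add (differentiableOn_const _)) hden
  have hTa : T a = 0 := by simp [hT, hYa]
  have hnsq : ∀ w : ℂ, ‖w‖ ^ 2 = w.re ^ 2 + w.im ^ 2 := by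
    intro w; rw [← Complex.normSq_eq_norm_sq, Complex.normSq_apply]; ring
  have hT1 : MapsTo T (Metric.ball a R) (Metric.closedBall (T a) 1) := by
    intro z hz
    rw [hTa, mem_closedBall_zero_iff, norm_div]
    rw [div_le_one (norm_pos_iff.2 (hden z hz))]
    apply le_of_sq_le_sq _ (norm_nonneg _)
    rw [hnsq, hnsq]
    simp only [Complex.sub_re, Complex.sub_im, Complex.add_re, Complex.add_im, Complex.ofReal_re,
      Complex.ofReal_im, hYre]
    nlinarith [hpos z hz]
  have h3 := Complex.dist_le_div_mul_dist_of_mapsTo_ball hTd hT1 hbR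
  have h4 : ‖T b‖ ≤ 1 / 2 := by
    rw [hTa, dist_zero_right] at h3
    refine h3.trans ?_
    have := Metric.mem_ball.1 hb
    rw [div_mul_eq_mul_div, one_mul, div_le_iff₀ hR]
    linarith
  have h5 : 2 * ‖Y b - c‖ ≤ ‖Y b + c‖ := by
    rw [hT] at h4
    simp only [norm_div] at h4
    rw [div_le_iff₀ (norm_pos_iff.2 (hden b hbR))] at h4
    linarith
  have h6 : (2 * ‖Y b - c‖) ^ 2 ≤ ‖Y b + c‖ ^ 2 := by
    gcongr
  rw [mul_pow, hnsq, hnsq] at h6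
  simp only [Complex.sub_re, Complex.sub_im, Complex.add_re, Complex.add_im, Complex.ofReal_re,
      Complex.ofReal_im, hYre] at h6
  -- The disc `‖Y - c‖ ≤ ‖Y + c‖ / 2` has real parts in `[c/3, 3c]`; this factor 3 becomes the
  -- exponent in the conclusion.
  have h7 : (3 * (Q b).re - c) * ((Q b).re - 3 * c) ≤ 0 := by nlinarith
  have hbp := hpos b hbR
  have h8 : c ≤ 3 * (Q b).re := by
    by_contra h; push Not at h
    nlinarith
  have h9 : (Q b).re ≤ 3 * c := by
    by_contra h; push Not at h
    nlinarith
  rw [hn b hbR, hn a ha, mul_pow, mul_pow, ← Real.exp_nat_mul, ← Real.exp_nat_mul]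
  have e1 : M ^ 2 * (M * Real.exp (-(Q a).re)) = M ^ 3 * Real.exp (-(Q a).re) := by ring
  have e2 : M ^ 2 * (M * Real.exp (-(Q b).re)) = M ^ 3 * Real.exp (-(Q b).re) := by ring
  rw [e1, e2]
  constructor
  · gcongr
    push_cast; linarith
  · gcongr
    push_cast; linarith

/-- Montel's theorem for a bounded sequence of holomorphic functions on a disc. -/
theorem exists_subseq_tendstoLocallyUniformlyOn {z : ℂ} {R M : ℝ} (hR : 0 < R) {F : ℕ → ℂ → ℂ}
    (hF : ∀ n, DifferentiableOn ℂ (F n) (Metric.ball z R))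
    (hM : ∀ n, ∀ w ∈ Metric.ball z R, ‖F n w‖ ≤ M) :
    ∃ φ : ℕ → ℕ, StrictMono φ ∧ ∃ g : ℂ → ℂ,
      TendstoLocallyUniformlyOn (fun m => F (φ m)) g atTop (Metric.ball z (R / 2)) := by
  have hsub : Metric.closedBall z (R / 2) ⊆ Metric.ball z R :=
    Metric.closedBall_subset_ball (by linarith)
  have hM0 : 0 ≤ M := (norm_nonneg _).trans (hM 0 z (Metric.mem_ball_self hR))
  -- Close points: the Schwarz lemma on the disc of radius `R / 2` about `y`, where the oscillation
  -- is at most `2 * M`. Distant points: the trivial bound `2 * M`. The Lipschitz constant gives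
  -- equicontinuity for Arzelà–Ascoli.
  have hlip : ∀ n, ∀ x ∈ Metric.closedBall z (R / 2), ∀ y ∈ Metric.closedBall z (R / 2),
      dist (F n x) (F n y) ≤ 4 * M / R * dist x y := by
    intro n x hx y hy
    rcases lt_or_ge (dist x y) (R / 2) with h | h
    · have hs : Metric.ball y (R / 2) ⊆ Metric.ball z R := by
        apply Metric.ball_subset_ball'
        have := Metric.mem_closedBall.1 hy; linarith
      have := Complex.dist_le_div_mul_dist_of_mapsTo_ball (f := F n) (c := y) (R₁ := R / 2)
        (R₂ := 2 * M) (z := x) ((hF n).mono hs) (fun w hw => by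
          rw [Metric.mem_closedBall, dist_eq_norm]
          have h1 := norm_sub_le (F n w) (F n y)
          have h2 := hM n w (hs hw)
          have h3 := hM n y (hsub hy)
          linarith) h
      refine this.trans_eq ?_
      field_simp; ring
    · have h1 := dist_le_norm_add_norm (F n x) (F n y)
      have h2 := hM n x (hsub hx)
      have h3 := hM n y (hsub hy)
      have h4 : 4 * M / R * (R / 2) ≤ 4 * M / R * dist x y := by gcongr
      have h5 : 4 * M / R * (R / 2) = 2 * M := by field_simp; ring
      linarith
  let X := Metric.closedBall z (R / 2)
  have : CompactSpace X := isCompact_iff_compactSpace.1 (isCompact_closedBall _ _)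
  let G : ℕ → BoundedContinuousFunction X ℂ := fun n =>
    BoundedContinuousFunction.mkOfCompact ⟨fun x : X => F n x,
      continuousOn_iff_continuous_domRestrict.1 ((hF n).continuousOn.mono hsub)⟩
  have hcomp : IsCompact (closure (range G)) := by
    apply BoundedContinuousFunction.arzela_ascoli (Metric.closedBall (0 : ℂ) M)
      (isCompact_closedBall _ _)
    · rintro f x ⟨n, rfl⟩
      exact mem_closedBall_zero_iff.2 (hM n x (hsub x.2))
    · intro x₀
      rw [Metric.equicontinuousAt_iff]
      intro ε hε
      refine ⟨ε / (4 * M / R + 1), by positivity, ?_⟩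
      rintro x hx ⟨_, n, rfl⟩
      have h1 := hlip n x₀ x₀.2 x x.2
      simp only [G, BoundedContinuousFunction.mkOfCompact_apply]
      refine h1.trans_lt ?_
      rw [lt_div_iff₀ (by positivity)] at hx
      have h2 : dist (x₀ : ℂ) x = dist x x₀ := by rw [dist_comm]; rfl
      rw [h2]
      have h3 : 0 ≤ dist x x₀ := dist_nonneg
      nlinarith
  obtain ⟨g, -, φ, hφ, hlim⟩ := hcomp.tendsto_subseq (x := G) (fun n => subset_closure ⟨n, rfl⟩)
  classical
  refine ⟨φ, hφ, fun w => if h : w ∈ X then g ⟨w, h⟩ else 0, ?_⟩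
  have hu : TendstoUniformlyOn (fun m => F (φ m)) (fun w => if h : w ∈ X then g ⟨w, h⟩ else 0)
      atTop X := by
    rw [Metric.tendstoUniformlyOn_iff]
    intro ε hε
    filter_upwards [(Metric.tendsto_nhds.1 hlim) ε hε] with m hm w hw
    have h1 := BoundedContinuousFunction.dist_coe_le_dist (f := G (φ m)) (g := g) ⟨w, hw⟩
    rw [dif_pos hw, dist_comm]
    refine lt_of_le_of_lt ?_ hm
    exact h1
  exact (hu.mono Metric.ball_subset_closedBall).tendstoLocallyUniformlyOn

/-- Normality criterion: if the iterates of an entire function on a disc all omit a fixed disc,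
then the centre belongs to the Fatou set. -/
theorem mem_fatouSet_of_omits_ball {f : ℂ → ℂ} (hf : Differentiable ℂ f) {z v : ℂ} {δ ρ : ℝ}
    (hδ : 0 < δ) (hρ : 0 < ρ)
    (h : ∀ n, ∀ w ∈ Metric.ball z δ, f^[n] w ∉ Metric.ball v ρ) : z ∈ fatouSet f := by
  have hfn : ∀ n, Differentiable ℂ (f^[n]) := fun n => hf.iterate n
  have hge : ∀ n, ∀ w ∈ Metric.ball z δ, ρ ≤ ‖f^[n] w - v‖ := by
    intro n w hw
    have := h n w hw
    rwa [Metric.mem_ball, not_lt, dist_eq_norm] at this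
  set M := 2 / ρ with hMdef
  have hMpos : 0 < M := by positivity
  have hne : ∀ n, ∀ w ∈ Metric.ball z δ, f^[n] w - v ≠ 0 := fun n w hw =>
    norm_pos_iff.1 (hρ.trans_le (hge n w hw))
  let g : ℕ → ℂ → ℂ := fun n w => (f^[n] w - v)⁻¹
  have hgd : ∀ n, DifferentiableOn ℂ (g n) (Metric.ball z δ) := fun n =>
    ((hfn n).sub_const v).differentiableOn.inv (hne n)
  have hg0 : ∀ n, ∀ w ∈ Metric.ball z δ, g n w ≠ 0 := fun n w hw => inv_ne_zero (hne n w hw)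
  have hgM : ∀ n, ∀ w ∈ Metric.ball z δ, ‖g n w‖ < M := by
    intro n w hw
    simp only [g, norm_inv, hMdef]
    have h1 := hge n w hw
    calc ‖f^[n] w - v‖⁻¹ ≤ ρ⁻¹ := by gcongr
      _ < 2 / ρ := by rw [inv_eq_one_div]; gcongr; norm_num
  have hH := fun n b (hb : b ∈ Metric.ball z (δ / 2)) =>
    norm_pow_three_le_of_ne_zero (hgd n) (hg0 n) (hgM n) hb
  refine ⟨δ / 4, by positivity, fun n => ?_⟩
  have hsub2 : Metric.ball z (δ / 2) ⊆ Metric.ball z δ := Metric.ball_subset_ball (by linarith)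
  -- By Harnack, the values of `g n` at the centre control it on the half-size disc. If they come
  -- arbitrarily close to 0, a subsequence of iterates tends to `∞` uniformly; otherwise the
  -- iterates are eventually uniformly bounded and Montel's theorem applies.
  by_cases hcase : ∀ ε > 0, ∃ᶠ k in atTop, ‖g (n k) z‖ < ε
  · have : ∀ j : ℕ, ∃ᶠ k in atTop, ‖g (n k) z‖ < 1 / ((j : ℝ) + 1) := fun j =>
      hcase _ (by positivity)
    obtain ⟨φ, hφ, hφ2⟩ := extraction_forall_of_frequently this
    refine ⟨φ, hφ, Or.inr ?_⟩
    intro K hK _ T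
    have hpow : Tendsto (fun j : ℕ => 1 / ((j : ℝ) + 1)) atTop (𝓝 0) :=
      tendsto_one_div_add_atTop_nhds_zero_nat
    set ε : ℝ := 1 / (|T| + ‖v‖ + 1) with hε
    have hεpos : 0 < ε := by positivity
    have : ∀ᶠ j : ℕ in atTop, 1 / ((j : ℝ) + 1) < ε ^ 3 / M ^ 2 :=
      hpow.eventually (gt_mem_nhds (by positivity))
    filter_upwards [this] with j hj w hw
    have hwb : w ∈ Metric.ball z (δ / 2) :=
      Metric.ball_subset_ball (by linarith) (hK hw)
    have h1 := (hH (n (φ j)) w hwb).1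
    have h2 := (hφ2 j).trans hj
    have h3 : ‖g (n (φ j)) w‖ ^ 3 < ε ^ 3 := by
      refine h1.trans_lt ?_
      rw [lt_div_iff₀ (by positivity)] at h2
      linarith
    have h4 : ‖g (n (φ j)) w‖ < ε := lt_of_pow_lt_pow_left₀ 3 hεpos.le h3
    simp only [g, norm_inv] at h4
    have h5 : |T| + ‖v‖ + 1 < ‖f^[n (φ j)] w - v‖ := by
      have hp : 0 < ‖f^[n (φ j)] w - v‖ := hρ.trans_le (hge _ w (hsub2 hwb))
      rw [hε, inv_eq_one_div] at h4
      exact lt_of_one_div_lt_one_div hp h4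
    have h6 := norm_sub_le (f^[n (φ j)] w) v
    have h7 := le_abs_self T
    linarith
  · push Not at hcase
    obtain ⟨ε, hε, hev⟩ := hcase
    obtain ⟨N, hN⟩ := eventually_atTop.1 hev
    have hbd : ∀ k, ∀ w ∈ Metric.ball z (δ / 2), ‖f^[n (N + k)] w‖ ≤ M ^ 2 / ε ^ 3 + ‖v‖ := by
      intro k w hw
      have h1 := (hH (n (N + k)) w hw).2
      have h2 : ε ^ 3 ≤ M ^ 2 * ‖g (n (N + k)) w‖ := by
        refine le_trans ?_ h1
        gcongr
        exact hN _ (by omega)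
      have hp : 0 < ‖f^[n (N + k)] w - v‖ := hρ.trans_le (hge _ w (hsub2 hw))
      have h3 : ‖f^[n (N + k)] w - v‖ ≤ M ^ 2 / ε ^ 3 := by
        simp only [g, norm_inv] at h2
        rw [le_div_iff₀ (by positivity)]
        rw [← div_eq_mul_inv, le_div_iff₀ hp] at h2
        linarith
      have h4 := norm_sub_norm_le (f^[n (N + k)] w) v
      linarith
    obtain ⟨φ, hφ, G, hG⟩ := exists_subseq_tendstoLocallyUniformlyOn (z := z) (R := δ / 2)
      (by positivity) (F := fun k => f^[n (N + k)]) (fun k => (hfn _).differentiableOn) hbd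
    refine ⟨fun m => N + φ m, fun a b hab => by simpa using hφ hab, Or.inl ⟨G, ?_⟩⟩
    convert hG using 2
    ring

/-! ### Inverse branches near Julia points -/

/-- Discs around Julia points are eventually mapped onto sets meeting any forward invariant set
with interior. -/
theorem exists_iterate_mem_of_mem_juliaSet {f : ℂ → ℂ} (hf : Differentiable ℂ f) {P : Set ℂ}
    (hP : MapsTo f P P) {v : ℂ} {ρ : ℝ} (hρ : 0 < ρ) (hv : Metric.ball v ρ ⊆ P) {z : ℂ}
    (hz : z ∈ juliaSet f) {η : ℝ} (hη : 0 < η) :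
    ∃ m₀, ∀ m ≥ m₀, ∃ x ∈ Metric.ball z η, f^[m] x ∈ P := by
  by_contra! hcon
  -- A point that has entered `P` stays there. If the disc misses `P` at arbitrarily late times, it
  -- therefore misses `P` at all times, and the criterion makes `z` a Fatou point.
  refine hz (mem_fatouSet_of_omits_ball (v := v) hf hη hρ fun n w hw hn => ?_)
  obtain ⟨m, hm, hx⟩ := hcon n
  refine hx w hw ?_
  obtain ⟨k, rfl⟩ := Nat.exists_eq_add_of_le' hm
  rw [Function.iterate_add_apply]
  exact (hP.iterate k) (hv hn)

/-- Inverse branches of high iterates that avoid a forward invariant set with interior and send the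
centre of a disc close to a Julia point send the whole half-size disc close to this point. -/
theorem inverse_branch_shrinks {f : ℂ → ℂ} (hf : Differentiable ℂ f) {P : Set ℂ}
    (hP : MapsTo f P P) {v : ℂ} {ρ : ℝ} (hρ : 0 < ρ) (hv : Metric.ball v ρ ⊆ P) {z : ℂ}
    (hz : z ∈ juliaSet f) {ε : ℝ} (hε : 0 < ε) (r : ℝ) :
    ∃ δ > 0, ∃ m₀, ∀ m ≥ m₀, ∀ (a : ℂ) (φ : ℂ → ℂ), DifferentiableOn ℂ φ (Metric.ball a r) →
      (∀ u ∈ Metric.ball a r, f^[m] (φ u) = u) → Disjoint (Metric.ball a r) P →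
      ‖φ a - z‖ < δ → ∀ b ∈ Metric.ball a (r / 2), ‖φ b - z‖ < ε := by
  -- `A` bounds `‖v - x‖` for `‖x - z‖ < δ ≤ 1`, and `M` strictly bounds the quotient `g` below. A
  -- value of `g` of size at most `κ` gives `‖φ - x‖ ≤ ε / 2`; the last term in `δ` makes Harnack's
  -- inequality yield `κ`.
  set A : ℝ := ‖v - z‖ + 1 with hA
  have hApos : 0 < A := by positivity
  set M : ℝ := 2 + A / ρ with hM
  have hMpos : 0 < M := by positivity
  set κ : ℝ := min (1 / 2) (ε / (4 * A)) with hκ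
  have hκpos : 0 < κ := lt_min (by norm_num) (by positivity)
  set δ : ℝ := min 1 (min (ε / 4) (ρ * κ ^ 3 / (2 * M ^ 2))) with hδ
  have hδpos : 0 < δ := lt_min one_pos (lt_min (by positivity) (by positivity))
  have hδ1 : δ ≤ 1 := min_le_left _ _
  have hδ2 : δ ≤ ε / 4 := (min_le_right _ _).trans (min_le_left _ _)
  have hδ3 : δ ≤ ρ * κ ^ 3 / (2 * M ^ 2) := (min_le_right _ _).trans (min_le_right _ _)
  obtain ⟨m₀, hm₀⟩ := exists_iterate_mem_of_mem_juliaSet hf hP hρ hv hz hδpos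
  refine ⟨δ, hδpos, m₀, fun m hm a φ hφ hinv hdisj ha b hb => ?_⟩
  obtain ⟨x, hx, hxP⟩ := hm₀ m hm
  have hr : 0 < r := by
    have := Metric.nonempty_ball.1 ⟨b, hb⟩; linarith
  have har : a ∈ Metric.ball a r := Metric.mem_ball_self hr
  have hbr : b ∈ Metric.ball a r := Metric.ball_subset_ball (by linarith) hb
  have hφx : ∀ u ∈ Metric.ball a r, φ u - x ≠ 0 := by
    intro u hu h
    rw [sub_eq_zero] at h
    rw [← h, hinv u hu] at hxP
    exact disjoint_left.1 hdisj hu hxP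
  have hφv : ∀ u ∈ Metric.ball a r, ρ ≤ ‖φ u - v‖ := by
    intro u hu
    by_contra! h
    have h1 : φ u ∈ P := hv (by rwa [Metric.mem_ball, dist_eq_norm])
    have h2 := hP.iterate m h1
    rw [hinv u hu] at h2
    exact disjoint_left.1 hdisj hu h2
  have hφv0 : ∀ u ∈ Metric.ball a r, φ u - v ≠ 0 := fun u hu =>
    norm_pos_iff.1 (hρ.trans_le (hφv u hu))
  have hxz : ‖x - z‖ < δ := by rwa [Metric.mem_ball, dist_eq_norm] at hx
  have hvx : ‖v - x‖ ≤ A := by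
    have h1 := norm_sub_le_norm_sub_add_norm_sub v z x
    rw [norm_sub_rev z x] at h1
    linarith
  -- `φ` omits `x`, because `f^[m] x ∈ P`, and omits the disc about `v`. The Möbius map with zero
  -- `x` and pole `v` therefore makes `φ` nonvanishing and bounded, so Harnack carries smallness
  -- from `a` to `b`.
  set g : ℂ → ℂ := fun u => (φ u - x) / (φ u - v) with hg
  have hgd : DifferentiableOn ℂ g (Metric.ball a r) :=
    (hφ.sub_const x).div (hφ.sub_const v) hφv0
  have hg0 : ∀ u ∈ Metric.ball a r, g u ≠ 0 := fun u hu => div_ne_zero (hφx u hu) (hφv0 u hu)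
  have hgM : ∀ u ∈ Metric.ball a r, ‖g u‖ < M := by
    intro u hu
    have h1 : g u = 1 + (v - x) / (φ u - v) := by
      simp only [hg]; field_simp [hφv0 u hu]; ring
    have h2 : ‖(v - x) / (φ u - v)‖ ≤ A / ρ := by
      rw [norm_div]; gcongr; exact hφv u hu
    rw [h1]
    calc _ ≤ ‖(1 : ℂ)‖ + ‖(v - x) / (φ u - v)‖ := norm_add_le _ _
      _ < M := by rw [norm_one, hM]; linarith
  have hga : ‖g a‖ ≤ 2 * δ / ρ := by
    simp only [hg, norm_div]
    have h1 := norm_sub_le_norm_sub_add_norm_sub (φ a) z x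
    rw [norm_sub_rev z x] at h1
    gcongr
    · linarith
    · exact hφv a har
  have hgb : ‖g b‖ ≤ κ := by
    have h1 := (norm_pow_three_le_of_ne_zero hgd hg0 hgM hb).1
    have h2 : M ^ 2 * ‖g a‖ ≤ κ ^ 3 := by
      calc M ^ 2 * ‖g a‖ ≤ M ^ 2 * (2 * δ / ρ) := by gcongr
        _ ≤ M ^ 2 * (2 * (ρ * κ ^ 3 / (2 * M ^ 2)) / ρ) := by gcongr
        _ = κ ^ 3 := by field_simp
    exact le_of_pow_le_pow_left₀ (n := 3) (by norm_num) hκpos.le (h1.trans h2)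
  have hgb2 : ‖g b‖ ≤ 1 / 2 := hgb.trans (min_le_left _ _)
  have hgb3 : ‖g b‖ ≤ ε / (4 * A) := hgb.trans (min_le_right _ _)
  have hid : (φ b - x) * (1 - g b) = (x - v) * g b := by
    have := hφv0 b hbr
    simp only [hg]; field_simp; ring
  have h1g : 1 / 2 ≤ ‖1 - g b‖ := by
    have := norm_sub_norm_le (1 : ℂ) (g b)
    rw [norm_one] at this; linarith
  have hφb : ‖φ b - x‖ ≤ ε / 2 := by
    have h1 := congrArg norm hid
    rw [norm_mul, norm_mul, norm_sub_rev x v] at h1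
    have h2 : ‖v - x‖ * ‖g b‖ ≤ A * (ε / (4 * A)) := by gcongr
    have h3 : A * (ε / (4 * A)) = ε / 4 := by field_simp
    have h4 : ‖φ b - x‖ * (1 / 2) ≤ ‖φ b - x‖ * ‖1 - g b‖ := by gcongr
    linarith
  have h1 := norm_sub_le_norm_sub_add_norm_sub (φ b) x z
  linarith

/-- The same along a chain of discs. -/
theorem inverse_branch_shrinks_chain {f : ℂ → ℂ} (hf : Differentiable ℂ f) {P : Set ℂ}
    (hP : MapsTo f P P) {v : ℂ} {ρ : ℝ} (hρ : 0 < ρ) (hv : Metric.ball v ρ ⊆ P) {z : ℂ}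
    (hz : z ∈ juliaSet f) (r : ℝ) (k : ℕ) {ε : ℝ} (hε : 0 < ε) :
    ∃ m₀, ∀ m ≥ m₀, ∀ (a d : ℂ) (φ : ℂ → ℂ), ‖d‖ < r / 2 →
      (∀ i ≤ k, DifferentiableOn ℂ φ (Metric.ball (a + i * d) r)) →
      (∀ i ≤ k, ∀ u ∈ Metric.ball (a + i * d) r, f^[m] (φ u) = u) →
      (∀ i ≤ k, Disjoint (Metric.ball (a + i * d) r) P) →
      φ a = z → ‖φ (a + k * d) - z‖ < ε := by
  induction k generalizing ε with
  | zero =>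
    refine ⟨0, fun m _ a d φ _ _ _ _ ha => ?_⟩
    simpa [ha] using hε
  | succ k ih =>
    -- `δ` is the accuracy the last disc needs at its centre. The threshold for `m` depends on the
    -- number of discs but not on their position or on the branch.
    obtain ⟨δ, hδ, m₁, hm₁⟩ := inverse_branch_shrinks hf hP hρ hv hz hε r
    obtain ⟨m₂, hm₂⟩ := ih hδ
    refine ⟨max m₁ m₂, fun m hm a d φ hd h1 h2 h3 ha => ?_⟩
    refine hm₁ m ((le_max_left _ _).trans hm) (a + k * d) φ (h1 k (by omega)) (h2 k (by omega))
      (h3 k (by omega)) ?_ _ ?_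
    · exact hm₂ m ((le_max_right _ _).trans hm) a d φ hd (fun i hi => h1 i (by omega))
        (fun i hi => h2 i (by omega)) (fun i hi => h3 i (by omega)) ha
    · rw [Metric.mem_ball, dist_eq_norm]
      have : a + ((k + 1 : ℕ) : ℂ) * d - (a + k * d) = d := by push_cast; ring
      rwa [this]

/-- Continuous inverse branches of iterates on a simply connected open set that avoids a forward
invariant set containing the omitted value. -/
theorem exists_inverse_branch {lam : ℂ} (hlam : lam ≠ 0) {P N : Set ℂ}
    (hP : MapsTo (expMap lam) P P) (h0 : (0 : ℂ) ∈ P) (hN : IsOpen N) (hNc : IsSimplyConnected N)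
    (hd : Disjoint N P) (m : ℕ) (z : ℂ) (hz : (expMap lam)^[m] z ∈ N) :
    ∃ φ : ℂ → ℂ, ContinuousOn φ N ∧ (∀ u ∈ N, (expMap lam)^[m] (φ u) = u) ∧
      φ ((expMap lam)^[m] z) = z := by
  induction m generalizing z with
  | zero => exact ⟨id, continuousOn_id, by simp, by simp⟩
  | succ m ih =>
    rw [Function.iterate_succ_apply] at hz
    obtain ⟨φ, hφc, hφ, hφz⟩ := ih (expMap lam z) hz
    -- Since 0 and its forward orbit lie in `P`, the branch never meets 0 and can be continued by a
    -- logarithm, normalised below by a multiple of `2πi`.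
    have hne : ∀ u ∈ N, φ u ≠ 0 := by
      intro u hu h
      have := hP.iterate m h0
      rw [← h, hφ u hu] at this
      exact disjoint_left.1 hd hu this
    obtain ⟨q, hqc, hq⟩ := Complex.exists_continuousOn_eqOn_exp_comp hNc hN
      (hφc.div_const lam) (by
        rintro ⟨u, hu, h⟩
        exact div_ne_zero (hne u hu) hlam h)
    set w := (expMap lam)^[m] (expMap lam z) with hw
    have hqw : Complex.exp (q w) = Complex.exp z := by
      have := hq hz
      simp only [Function.comp_apply] at this
      rw [this, hφz, expMap]; field_simp
    obtain ⟨s, hs⟩ := Complex.exp_eq_exp_iff_exists_int.1 hqw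
    refine ⟨fun u => q u - s * (2 * Real.pi * Complex.I), hqc.sub continuousOn_const, ?_, ?_⟩
    · intro u hu
      rw [Function.iterate_succ_apply]
      have h1 : expMap lam (q u - s * (2 * Real.pi * Complex.I)) = φ u := by
        have := hq hu
        simp only [Function.comp_apply] at this
        rw [expMap, Complex.exp_sub, Complex.exp_int_mul_two_pi_mul_I, this]; field_simp
      rw [h1, hφ u hu]
    · rw [Function.iterate_succ_apply, ← hw]
      simp only [hs]; ring

/-! ### The exponential map: periodicity, winding and components of preimages -/

theorem differentiable_expMap (lam : ℂ) : Differentiable ℂ (expMap lam) :=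
  Complex.differentiable_exp.const_mul lam

theorem continuous_expMap (lam : ℂ) : Continuous (expMap lam) :=
  (differentiable_expMap lam).continuous

theorem expMap_ne_zero {lam : ℂ} (hlam : lam ≠ 0) (z : ℂ) : expMap lam z ≠ 0 :=
  mul_ne_zero hlam (Complex.exp_ne_zero z)

theorem exists_hasDerivAt_iterate_expMap {lam : ℂ} (hlam : lam ≠ 0) (m : ℕ) (z : ℂ) :
    ∃ d ≠ 0, HasDerivAt (expMap lam)^[m] d z := by
  induction m generalizing z with
  | zero => exact ⟨1, one_ne_zero, by simpa using hasDerivAt_id z⟩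
  | succ m ih =>
    obtain ⟨d, hd, h⟩ := ih (expMap lam z)
    have h1 : HasDerivAt (expMap lam) (expMap lam z) z := (Complex.hasDerivAt_exp z).const_mul lam
    exact ⟨d * expMap lam z, mul_ne_zero hd (expMap_ne_zero hlam z), h.comp z h1⟩

/-- The iterates have no critical points, so the inverse function theorem upgrades continuity to
holomorphy. -/
theorem differentiableOn_of_inverse_branch {lam : ℂ} (hlam : lam ≠ 0) {N : Set ℂ} (hN : IsOpen N)
    {m : ℕ} {φ : ℂ → ℂ} (hc : ContinuousOn φ N) (h : ∀ u ∈ N, (expMap lam)^[m] (φ u) = u) :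
    DifferentiableOn ℂ φ N := by
  intro u hu
  obtain ⟨d, hd, hder⟩ := exists_hasDerivAt_iterate_expMap hlam m (φ u)
  exact (hder.of_local_left_inverse (hc.continuousAt (hN.mem_nhds hu)) hd
    (eventually_of_mem (hN.mem_nhds hu) h)).differentiableAt.differentiableWithinAt

theorem expMap_add_int (lam z : ℂ) (s : ℤ) :
    expMap lam (z + 2 * Real.pi * Complex.I * s) = expMap lam z := by
  have h : (2 : ℂ) * Real.pi * Complex.I * s = s * (2 * Real.pi * Complex.I) := by ring
  rw [expMap, expMap, Complex.exp_add, h, Complex.exp_int_mul_two_pi_mul_I, mul_one]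

theorem expMap_eq_expMap_iff {lam : ℂ} (hlam : lam ≠ 0) {x y : ℂ} :
    expMap lam x = expMap lam y ↔ ∃ s : ℤ, x = y + 2 * Real.pi * Complex.I * s := by
  constructor
  · intro h
    obtain ⟨s, hs⟩ := Complex.exp_eq_exp_iff_exists_int.1 (mul_left_cancel₀ hlam h)
    exact ⟨s, by rw [hs]; ring⟩
  · rintro ⟨s, rfl⟩
    exact expMap_add_int lam y s

theorem exists_expMap_eq {lam : ℂ} (hlam : lam ≠ 0) {u : ℂ} (hu : u ≠ 0) :
    ∃ x, expMap lam x = u :=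
  ⟨Complex.log (u / lam), by
    rw [expMap, Complex.exp_log (div_ne_zero hu hlam)]; field_simp⟩

theorem isOpenMap_expMap {lam : ℂ} (hlam : lam ≠ 0) : IsOpenMap (expMap lam) := by
  have h : expMap lam = (Homeomorph.mulLeft₀ lam hlam) ∘ Complex.exp := by
    ext z; simp [expMap]
  rw [h]
  exact (Homeomorph.isOpenMap _).comp Complex.isOpenMap_exp

theorem isOpenMap_iterate_expMap {lam : ℂ} (hlam : lam ≠ 0) (n : ℕ) :
    IsOpenMap (expMap lam)^[n] := by
  induction n with
  | zero => exact IsOpenMap.id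
  | succ n ih => exact ih.comp (isOpenMap_expMap hlam)

/-- The translate by `2πi` of a point of an arc can be joined to the point only by an arc whose
image under the exponential map separates `0` from `∞`. -/
theorem isBounded_of_disjoint_expMap_path {lam : ℂ} {x : ℂ} {s : ℤ} (hs : s ≠ 0)
    (β : Path x (x + 2 * Real.pi * Complex.I * s)) {W : Set ℂ} (hW : IsPreconnected W)
    (h0 : (0 : ℂ) ∈ W) (hd : ∀ t, expMap lam (β t) ∉ W) : Bornology.IsBounded W := by
  by_contra hunb
  set γ : unitInterval → ℂ := fun t => expMap lam (β t) with hγ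
  have hγc : Continuous γ := (continuous_expMap lam).comp β.continuous
  have hcl : IsClosed (range γ) := (isCompact_range hγc).isClosed
  have hγ01 : γ 0 = γ 1 := by simp only [hγ, β.source, β.target, expMap_add_int]
  -- `R a b` says that `(γ - a) / (γ - b)` has a logarithm that closes up along the curve: `γ` has
  -- equal winding numbers about `a` and `b`. The relation is transitive and holds between nearby
  -- points of `W`, hence throughout `W`.
  let R : ℂ → ℂ → Prop := fun a b => ∃ q : unitInterval → ℂ, Continuous q ∧ q 0 = q 1 ∧
    ∀ t, Complex.exp (q t) * (γ t - b) = γ t - a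
  have hnear : ∀ b ∈ W, ∀ᶠ a in 𝓝[W] b, R b a ∧ R a b := by
    intro b hb
    have hbr : b ∉ range γ := by rintro ⟨t, rfl⟩; exact hd t hb
    have hpos : 0 < Metric.infDist b (range γ) :=
      (hcl.notMem_iff_infDist_pos (range_nonempty γ)).1 hbr
    filter_upwards [mem_nhdsWithin_of_mem_nhds (Metric.ball_mem_nhds b hpos)] with a ha
    have hlt : ∀ t, ‖(b - a) / (γ t - b)‖ < 1 := by
      intro t
      have h1 : Metric.infDist b (range γ) ≤ dist b (γ t) := Metric.infDist_le_dist_of_mem ⟨t, rfl⟩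
      rw [dist_eq_norm, norm_sub_rev] at h1
      rw [Metric.mem_ball, dist_eq_norm, norm_sub_rev] at ha
      rw [norm_div, div_lt_one (by linarith)]
      linarith
    have hne : ∀ t, γ t - b ≠ 0 := fun t h => hbr ⟨t, by linear_combination h⟩
    have key : R a b := by
      refine ⟨fun t => Complex.log (1 + (b - a) / (γ t - b)), ?_, ?_, ?_⟩
      · refine Continuous.clog ?_ fun t => Complex.mem_slitPlane_of_norm_lt_one (hlt t)
        exact continuous_const.add (continuous_const.div (hγc.sub continuous_const) hne)
      · simp only [hγ01]
      · intro t
        rw [Complex.exp_log (Complex.slitPlane_ne_zero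
          (Complex.mem_slitPlane_of_norm_lt_one (hlt t)))]
        have := hne t
        field_simp; ring
    refine ⟨?_, key⟩
    obtain ⟨q, hq, hq01, hqe⟩ := key
    refine ⟨fun t => - q t, hq.neg, by simp [hq01], fun t => ?_⟩
    rw [← hqe t, ← mul_assoc, ← Complex.exp_add]; simp
  have htrans : ∀ a b c, R a b → R b c → R a c := by
    rintro a b c ⟨q, hq, hq01, hqe⟩ ⟨q', hq', hq01', hqe'⟩
    refine ⟨fun t => q t + q' t, hq.add hq', by simp [hq01, hq01'], fun t => ?_⟩
    rw [Complex.exp_add, mul_assoc, hqe', hqe]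
  obtain ⟨M, hM⟩ := (Metric.isBounded_iff_subset_closedBall 0).1 (isCompact_range hγc).isBounded
  -- About a point this far out the curve does not wind: `1 - γ / w` stays in the slit plane and has
  -- a principal logarithm.
  obtain ⟨w, hwW, hw⟩ : ∃ w ∈ W, |M| + 1 < ‖w‖ := by
    by_contra! h
    exact hunb ((Metric.isBounded_iff_subset_closedBall 0).2 ⟨|M| + 1, fun y hy => by
      simpa using h y hy⟩)
  have hR : R 0 w := by
    refine hW.induction₂' R ?_ (fun a b c _ _ _ => htrans a b c) h0 hwW
    intro b hb
    filter_upwards [hnear b hb] with a ha using ha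
  obtain ⟨q, hq, hq01, hqe⟩ := hR
  have hw0 : w ≠ 0 := by
    rintro rfl; simp at hw; linarith [abs_nonneg M]
  have hγw : ∀ t, ‖-(γ t / w)‖ < 1 := by
    intro t
    have h1 : ‖γ t‖ ≤ M := by simpa using hM ⟨t, rfl⟩
    rw [norm_neg, norm_div, div_lt_one (norm_pos_iff.2 hw0)]
    linarith [le_abs_self M]
  set q' : unitInterval → ℂ := fun t => Complex.log (1 + -(γ t / w)) with hq'
  have hq'c : Continuous q' :=
    Continuous.clog (continuous_const.add (hγc.div_const w).neg)
      fun t => Complex.mem_slitPlane_of_norm_lt_one (hγw t)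
  have hq'e : ∀ t, Complex.exp (q' t) = 1 + -(γ t / w) := fun t =>
    Complex.exp_log (Complex.slitPlane_ne_zero (Complex.mem_slitPlane_of_norm_lt_one (hγw t)))
  have hconst : ∀ t, Complex.exp (q t + q' t - β t) = - lam / w := by
    intro t
    have h1 := hqe t
    rw [Complex.exp_sub, Complex.exp_add, hq'e t, div_eq_div_iff (Complex.exp_ne_zero _) hw0]
    have h2 : γ t = lam * Complex.exp (β t) := rfl
    have h3 : (1 + -(γ t / w)) * w = -(γ t - w) := by field_simp; ring
    linear_combination Complex.exp (q t) * h3 - h1 - h2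
  -- Thus `q + q'` and `β` differ by a constant, yet `q + q'` has equal endpoint values while those
  -- of `β` differ by `2πi s`.
  have h := Complex.isCoveringMap_exp.const_of_comp
    (g := fun t : unitInterval => q t + q' t - β t)
    ((hq.add hq'c).sub β.continuous) (fun a b => Subtype.ext ((hconst a).trans (hconst b).symm)) 0 1
  simp only [hq', hγ01, hq01, β.source, β.target] at h
  have h2 : (2 : ℂ) * Real.pi * Complex.I * s = 0 := by linear_combination h
  have hpi : (Real.pi : ℂ) ≠ 0 := by exact_mod_cast Real.pi_ne_zero
  have hsc : (s : ℂ) ≠ 0 := by exact_mod_cast hs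
  exact mul_ne_zero (mul_ne_zero (mul_ne_zero two_ne_zero hpi) Complex.I_ne_zero) hsc h2

theorem add_mem_connectedComponentIn {S : Set ℂ} {c : ℂ} (hS : ∀ z ∈ S, z + c ∈ S) {x y : ℂ}
    (hy : y ∈ connectedComponentIn S x) : y + c ∈ connectedComponentIn S (x + c) := by
  have hx : x ∈ S := by
    by_contra h
    rw [connectedComponentIn_eq_empty h] at hy
    exact hy
  have h1 : IsPreconnected ((fun z => z + c) '' connectedComponentIn S x) :=
    isPreconnected_connectedComponentIn.image _ (by fun_prop)
  refine h1.subset_connectedComponentIn ⟨x, mem_connectedComponentIn hx, rfl⟩ ?_ ⟨y, hy, rfl⟩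
  rintro _ ⟨z, hz, rfl⟩
  exact hS z (connectedComponentIn_subset S x hz)

theorem add_mem_preimage_expMap {lam : ℂ} {G : Set ℂ} (s : ℤ) (z : ℂ)
    (hz : z ∈ expMap lam ⁻¹' G) : z + 2 * Real.pi * Complex.I * s ∈ expMap lam ⁻¹' G := by
  rwa [mem_preimage, expMap_add_int]

theorem isOpen_preimage_expMap {lam : ℂ} {G : Set ℂ} (hG : IsOpen G) :
    IsOpen (expMap lam ⁻¹' G) := hG.preimage (continuous_expMap lam)

/-- Each component of the preimage of a domain that omits `0` is mapped onto the domain. -/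
theorem image_connectedComponentIn_expMap {lam : ℂ} (hlam : lam ≠ 0) {G : Set ℂ} (hG : IsOpen G)
    (hGc : IsPreconnected G) (h0 : (0 : ℂ) ∉ G) {x : ℂ} (hx : expMap lam x ∈ G) :
    expMap lam '' connectedComponentIn (expMap lam ⁻¹' G) x = G := by
  set A := connectedComponentIn (expMap lam ⁻¹' G) x with hA
  have hAo : IsOpen A := (isOpen_preimage_expMap hG).connectedComponentIn
  have hAG : expMap lam '' A ⊆ G := by
    rintro _ ⟨y, hy, rfl⟩
    exact connectedComponentIn_subset (expMap lam ⁻¹' G) _ hy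
  refine hAG.antisymm fun u hu => ?_
  by_contra hu'
  -- By periodicity, a component whose image meets that of `A` is a translate of `A` and has the
  -- same image. Hence `Y` is open, and the images of `A` and `Y` would disconnect `G`.
  set Y : Set ℂ := {y | expMap lam y ∈ G ∧ expMap lam y ∉ expMap lam '' A} with hY
  have hYo : IsOpen Y := by
    rw [isOpen_iff_mem_nhds]
    rintro y ⟨hyG, hyA⟩
    have hyn : connectedComponentIn (expMap lam ⁻¹' G) y ∈ 𝓝 y :=
      (isOpen_preimage_expMap hG).connectedComponentIn.mem_nhds (mem_connectedComponentIn hyG)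
    filter_upwards [hyn] with y' hy'
    refine ⟨connectedComponentIn_subset (expMap lam ⁻¹' G) _ hy', ?_⟩
    rintro ⟨x', hx', hxy⟩
    obtain ⟨s, rfl⟩ := (expMap_eq_expMap_iff hlam).1 hxy
    have h1 := add_mem_connectedComponentIn
      (add_mem_preimage_expMap (lam := lam) (G := G) s) hy'
    have h2 := connectedComponentIn_eq h1
    rw [connectedComponentIn_eq hx', ← h2] at hA
    refine hyA ⟨y + 2 * Real.pi * Complex.I * s, ?_, expMap_add_int lam y s⟩
    rw [hA]
    exact mem_connectedComponentIn (by rwa [mem_preimage, expMap_add_int])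
  obtain ⟨v, hvG, ⟨a, ha, rfl⟩, b, hb, hab⟩ := hGc (expMap lam '' A) (expMap lam '' Y)
    (isOpenMap_expMap hlam _ hAo) (isOpenMap_expMap hlam _ hYo) (by
      intro v hv
      by_cases h : v ∈ expMap lam '' A
      · exact Or.inl h
      · obtain ⟨y, rfl⟩ := exists_expMap_eq hlam (u := v) (by rintro rfl; exact h0 hv)
        exact Or.inr ⟨y, ⟨hv, h⟩, rfl⟩) ⟨expMap lam x, hx, x, mem_connectedComponentIn hx, rfl⟩ (by
      obtain ⟨y, rfl⟩ := exists_expMap_eq hlam (u := u) (by rintro rfl; exact h0 hu)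
      exact ⟨_, hu, y, ⟨hu, hu'⟩, rfl⟩)
  exact hb.2 (hab ▸ ⟨a, ha, rfl⟩)

theorem isPreconnected_halfPlane_re_lt (c : ℝ) : IsPreconnected {z : ℂ | z.re < c} :=
  (convex_halfSpace_re_lt c).isPreconnected

/-- The preimage of a domain that contains `0` is connected. -/
theorem mem_connectedComponentIn_preimage_expMap {lam : ℂ} (hlam : lam ≠ 0) {G : Set ℂ}
    (hG : IsOpen G) (hGc : IsPreconnected G) (h0 : (0 : ℂ) ∈ G) {x y : ℂ}
    (hx : expMap lam x ∈ G) (hy : expMap lam y ∈ G) :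
    y ∈ connectedComponentIn (expMap lam ⁻¹' G) x := by
  obtain ⟨δ, hδ, hball⟩ := Metric.isOpen_iff.1 hG 0 h0
  have hl : 0 < ‖lam‖ := norm_pos_iff.2 hlam
  set c := Real.log (δ / ‖lam‖) with hc
  have hH : {z : ℂ | z.re < c} ⊆ expMap lam ⁻¹' G := by
    intro z hz
    apply hball
    rw [mem_ball_zero_iff, expMap, norm_mul, Complex.norm_exp]
    have : Real.exp z.re < δ / ‖lam‖ := by
      rw [← Real.exp_log (show 0 < δ / ‖lam‖ by positivity)]
      exact Real.exp_lt_exp.2 hz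
    rw [lt_div_iff₀ hl] at this
    linarith
  set x₀ : ℂ := ((c - 1 : ℝ) : ℂ) with hx₀
  have hx₀H : x₀ ∈ {z : ℂ | z.re < c} := by simp [hx₀]
  set A := connectedComponentIn (expMap lam ⁻¹' G) x₀ with hA
  have hHA : {z : ℂ | z.re < c} ⊆ A :=
    (isPreconnected_halfPlane_re_lt c).subset_connectedComponentIn hx₀H hH
  have hAo : IsOpen A := (isOpen_preimage_expMap hG).connectedComponentIn
  have hAinv : ∀ y ∈ A, ∀ s : ℤ, y + 2 * Real.pi * Complex.I * s ∈ A := by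
    intro y hy s
    have h1 := add_mem_connectedComponentIn
      (add_mem_preimage_expMap (lam := lam) (G := G) s) hy
    have h2 : x₀ + 2 * Real.pi * Complex.I * s ∈ A := by
      apply hHA
      simp [hx₀]
    rw [← connectedComponentIn_eq h2] at h1
    exact h1
  set Y : Set ℂ := {y | expMap lam y ∈ G ∧ y ∉ A} with hY
  have hYo : IsOpen Y := by
    rw [isOpen_iff_mem_nhds]
    rintro y ⟨hyG, hyA⟩
    have hyn : connectedComponentIn (expMap lam ⁻¹' G) y ∈ 𝓝 y :=
      (isOpen_preimage_expMap hG).connectedComponentIn.mem_nhds (mem_connectedComponentIn hyG)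
    filter_upwards [hyn] with y' hy'
    refine ⟨connectedComponentIn_subset (expMap lam ⁻¹' G) _ hy', fun h => hyA ?_⟩
    rw [hA, connectedComponentIn_eq h, ← connectedComponentIn_eq hy']
    exact mem_connectedComponentIn hyG
  have hball' : ∀ u ∈ Metric.ball (0 : ℂ) δ, u ≠ 0 → u ∈ expMap lam '' A := by
    intro u hu hu0
    refine ⟨Complex.log (u / lam), hHA ?_, ?_⟩
    · simp only [mem_ofPred_eq, Complex.log_re, hc, norm_div]
      rw [mem_ball_zero_iff] at hu
      exact Real.log_lt_log (by positivity) (by gcongr)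
    · rw [expMap, Complex.exp_log (div_ne_zero hu0 hlam)]; field_simp
  have hall : ∀ y, expMap lam y ∈ G → y ∈ A := by
    intro y hyG
    by_contra hyA
    -- The disc about 0 is added because 0 is never a value; its other points are values on the left
    -- half-plane, hence on `A`. Periodicity of `A` makes its image disjoint from that of `Y`.
    obtain ⟨v, -, hv, b, hb, hab⟩ := hGc (expMap lam '' A ∪ Metric.ball 0 δ) (expMap lam '' Y)
      ((isOpenMap_expMap hlam _ hAo).union Metric.isOpen_ball) (isOpenMap_expMap hlam _ hYo) (by
        intro v hv
        by_cases hv0 : v = 0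
        · exact Or.inl (Or.inr (by simpa [hv0] using hδ))
        obtain ⟨y, rfl⟩ := exists_expMap_eq hlam hv0
        by_cases h : y ∈ A
        · exact Or.inl (Or.inl ⟨y, h, rfl⟩)
        · exact Or.inr ⟨y, ⟨hv, h⟩, rfl⟩) ⟨0, h0, Or.inr (by simpa using hδ)⟩
        ⟨_, hyG, y, ⟨hyG, hyA⟩, rfl⟩
    have hv' : v ∈ expMap lam '' A := by
      rcases hv with h | h
      · exact h
      · exact hball' v h (hab ▸ expMap_ne_zero hlam b)
    obtain ⟨a, ha, rfl⟩ := hv'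
    obtain ⟨s, rfl⟩ := (expMap_eq_expMap_iff hlam).1 hab
    exact hb.2 (hAinv a ha s)
  rw [← connectedComponentIn_eq (hall x hx)]
  exact hall y hy

/-- If a component of the preimage of a domain omitting `0` does not contain two points that differ
by a multiple of `2πi`, then the exponential map has a continuous inverse from the domain onto this
component. -/
theorem exists_inverse_expMap {lam : ℂ} (hlam : lam ≠ 0) {G : Set ℂ} (hG : IsOpen G)
    (hGc : IsPreconnected G) (h0 : (0 : ℂ) ∉ G) {x : ℂ} (hx : expMap lam x ∈ G)
    (hinj : ∀ (y : ℂ) (s : ℤ), y ∈ connectedComponentIn (expMap lam ⁻¹' G) x →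
      y + 2 * Real.pi * Complex.I * s ∈ connectedComponentIn (expMap lam ⁻¹' G) x → s = 0) :
    ∃ l : ℂ → ℂ, ContinuousOn l G ∧
      (∀ u ∈ G, l u ∈ connectedComponentIn (expMap lam ⁻¹' G) x ∧ expMap lam (l u) = u) ∧
      ∀ y ∈ connectedComponentIn (expMap lam ⁻¹' G) x, l (expMap lam y) = y := by
  have him := image_connectedComponentIn_expMap hlam hG hGc h0 hx
  set A := connectedComponentIn (expMap lam ⁻¹' G) x with hA
  have hAo : IsOpen A := (isOpen_preimage_expMap hG).connectedComponentIn
  have hi : ∀ y ∈ A, ∀ y' ∈ A, expMap lam y = expMap lam y' → y = y' := by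
    intro y hy y' hy' h
    obtain ⟨s, rfl⟩ := (expMap_eq_expMap_iff hlam).1 h
    rw [hinj y' s hy' hy]; simp
  have hex : ∀ u : ℂ, ∃ y, u ∈ G → y ∈ A ∧ expMap lam y = u := by
    intro u
    by_cases hu : u ∈ G
    · rw [← him] at hu
      obtain ⟨y, hy, h⟩ := hu
      exact ⟨y, fun _ => ⟨hy, h⟩⟩
    · exact ⟨0, fun h => absurd h hu⟩
  choose l hl using hex
  refine ⟨l, fun u hu => ContinuousAt.continuousWithinAt ?_, hl, ?_⟩
  · intro V hV
    have h1 : V ∩ A ∈ 𝓝 (l u) := inter_mem hV (hAo.mem_nhds (hl u hu).1)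
    have h2 := (isOpenMap_expMap hlam).image_mem_nhds h1
    rw [(hl u hu).2] at h2
    rw [mem_map]
    filter_upwards [h2, hG.mem_nhds hu] with w hw hwG
    obtain ⟨y, ⟨hyV, hyA⟩, rfl⟩ := hw
    rw [mem_preimage, hi _ (hl _ hwG).1 y hyA (hl _ hwG).2]
    exact hyV
  · intro y hy
    have hyG : expMap lam y ∈ G := connectedComponentIn_subset (expMap lam ⁻¹' G) _ hy
    exact hi _ (hl _ hyG).1 y hy (hl _ hyG).2

/-- Two points of one component of the preimage of an open set which differ by a nonzero multiple of
`2πi` yield a compact set in the image that separates `0` from `∞`. -/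
theorem exists_isCompact_of_translate_mem {lam : ℂ} {G : Set ℂ} (hG : IsOpen G) {x y : ℂ} {s : ℤ}
    (hs : s ≠ 0) (hy : y ∈ connectedComponentIn (expMap lam ⁻¹' G) x)
    (hys : y + 2 * Real.pi * Complex.I * s ∈ connectedComponentIn (expMap lam ⁻¹' G) x) :
    ∃ Γ ⊆ G, IsCompact Γ ∧ ∀ W, IsPreconnected W → (0 : ℂ) ∈ W → Disjoint Γ W →
      Bornology.IsBounded W := by
  have hpc : IsPathConnected (connectedComponentIn (expMap lam ⁻¹' G) x) :=
    ((isOpen_preimage_expMap hG).connectedComponentIn.isConnected_iff_isPathConnected).1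
      ⟨⟨y, hy⟩, isPreconnected_connectedComponentIn⟩
  obtain ⟨β, hβ⟩ := hpc.joinedIn y hy _ hys
  have hc : Continuous fun t => expMap lam (β t) := (continuous_expMap lam).comp β.continuous
  refine ⟨range fun t => expMap lam (β t), ?_, isCompact_range hc, fun W hW h0 hd => ?_⟩
  · rintro _ ⟨t, rfl⟩
    exact connectedComponentIn_subset (expMap lam ⁻¹' G) _ (hβ t)
  · exact isBounded_of_disjoint_expMap_path hs β hW h0 fun t ht =>
      disjoint_left.1 hd ⟨t, rfl⟩ ht

/-! ### Frontiers and complements of plane domains -/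

theorem disjoint_frontier_connectedComponentIn {S : Set ℂ} (hS : IsOpen S) (x : ℂ) :
    Disjoint (frontier (connectedComponentIn S x)) S := by
  rw [disjoint_left]
  intro y hy hyS
  have ho : IsOpen (connectedComponentIn S y) := hS.connectedComponentIn
  have hyy := mem_connectedComponentIn hyS
  obtain ⟨w, hw, hwx⟩ := mem_closure_iff.1 hy.1 _ ho hyy
  rw [connectedComponentIn_eq hw, ← connectedComponentIn_eq hwx] at hyy
  rw [hS.connectedComponentIn.frontier_eq] at hy
  exact hy.2 hyy

/-- The complement of an open set with connected frontier is connected. -/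
theorem isPreconnected_compl_of_frontier {C : Set ℂ} (hC : IsOpen C)
    (hf : IsPreconnected (frontier C)) (hne : (frontier C).Nonempty) : IsPreconnected Cᶜ := by
  obtain ⟨x₀, hx₀⟩ := hne
  have hfC : frontier C ⊆ Cᶜ := by
    rw [hC.frontier_eq]; exact fun y hy => hy.2
  refine isPreconnected_of_forall x₀ fun y hy => ?_
  by_cases hyc : y ∈ closure C
  · exact ⟨frontier C, hfC, hx₀, by rw [hC.frontier_eq]; exact ⟨hyc, hy⟩, hf⟩
  -- The frontier of this exterior component is nonempty and lies in `frontier C`, so its closure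
  -- can be glued to the connected set `frontier C`.
  set O := connectedComponentIn (closure C)ᶜ y with hO
  have hyO : y ∈ O := mem_connectedComponentIn hyc
  have hS : IsOpen (closure C)ᶜ := isClosed_closure.isOpen_compl
  have hOS : O ⊆ (closure C)ᶜ := connectedComponentIn_subset _ _
  have hOC : closure O ⊆ Cᶜ := by
    refine closure_minimal (hOS.trans ?_) hC.isClosed_compl
    exact compl_subset_compl.2 subset_closure
  have hfr : (frontier O).Nonempty := by
    rw [nonempty_frontier_iff]
    refine ⟨⟨y, hyO⟩, fun h => ?_⟩
    exact hOS (h ▸ mem_univ x₀) hx₀.1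
  obtain ⟨v, hv⟩ := hfr
  have hvC : v ∈ frontier C := by
    rw [hC.frontier_eq]
    refine ⟨?_, hOC hv.1⟩
    by_contra h
    exact disjoint_left.1 (disjoint_frontier_connectedComponentIn hS y) hv h
  refine ⟨closure O ∪ frontier C, union_subset hOC hfC, Or.inr hx₀, Or.inl (subset_closure hyO), ?_⟩
  exact IsPreconnected.union v hv.1 hvC isPreconnected_connectedComponentIn.closure hf

/-! ### The basin of an attracting cycle -/

/-- The points attracted by `a` under the iterates of `f^p`. -/
def attractedSet (f : ℂ → ℂ) (p : ℕ) (a : ℂ) : Set ℂ :=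
  {z | Tendsto (fun n : ℕ => f^[n * p] z) atTop (𝓝 a)}

section Basin

variable {f : ℂ → ℂ} {p : ℕ} {z₀ : ℂ}

theorem IsAttractingPeriodicPt.iterate_eq (h : IsAttractingPeriodicPt f p z₀) :
    f^[p] z₀ = z₀ := by
  have := Function.iterate_minimalPeriod (f := f) (x := z₀)
  rwa [h.2.1] at this

theorem IsAttractingPeriodicPt.iterate_inj (h : IsAttractingPeriodicPt f p z₀) {i j : ℕ}
    (hi : i < p) (hj : j < p) (hij : f^[i] z₀ = f^[j] z₀) : i = j :=
  Function.iterate_injOn_Iio_minimalPeriod (by simpa [h.2.1] using hi)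
    (by simpa [h.2.1] using hj) hij

theorem iterate_mem_attractedSet (hf : Continuous f) {a z : ℂ} (hz : z ∈ attractedSet f p a)
    (i : ℕ) : f^[i] z ∈ attractedSet f p (f^[i] a) := by
  have h1 := ((hf.iterate i).tendsto a).comp hz
  refine h1.congr fun n => ?_
  simp only [Function.comp_apply, ← Function.iterate_add_apply, add_comm]

theorem mem_attractedSet_of_iterate {a z : ℂ} (m : ℕ) (hz : f^[m * p] z ∈ attractedSet f p a) :
    z ∈ attractedSet f p a := by
  have h1 : Tendsto (fun n : ℕ => f^[(n + m) * p] z) atTop (𝓝 a) := by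
    refine Tendsto.congr (fun n => ?_) hz
    rw [← Function.iterate_add_apply, add_mul]
  exact (tendsto_add_atTop_iff_nat (f := fun n => f^[n * p] z) m).1 h1

theorem iterate_mul_mem_attractedSet {a z : ℂ} (m : ℕ) (hz : z ∈ attractedSet f p a) :
    f^[m * p] z ∈ attractedSet f p a := by
  have h1 := (tendsto_add_atTop_iff_nat (f := fun n => f^[n * p] z) m).2 hz
  refine Tendsto.congr (fun n => ?_) h1
  rw [← Function.iterate_add_apply, add_mul]

/-- A disc around an attracting periodic point which is mapped into itself and attracted. -/
theorem IsAttractingPeriodicPt.exists_trap (hf : Differentiable ℂ f)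
    (h : IsAttractingPeriodicPt f p z₀) :
    ∃ r > 0, (∀ z ∈ Metric.closedBall z₀ r, f^[p] z ∈ Metric.ball z₀ r) ∧
      Metric.closedBall z₀ r ⊆ attractedSet f p z₀ := by
  have hd : HasDerivAt (f^[p]) (deriv (f^[p]) z₀) z₀ :=
    ((hf.iterate p).differentiableAt).hasDerivAt
  -- Any `c` between the modulus of the multiplier and 1 is a contraction factor near `z₀`.
  obtain ⟨c, hc1, hc2⟩ := exists_between h.2.2
  have hc0 : 0 ≤ c := (norm_nonneg _).trans hc1.le
  have hev := hd.isLittleO.bound (sub_pos.2 hc1)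
  obtain ⟨r, hr, hrb⟩ := Metric.nhds_basis_closedBall.eventually_iff.1 hev
  have hcontr : ∀ z ∈ Metric.closedBall z₀ r, ‖f^[p] z - z₀‖ ≤ c * ‖z - z₀‖ := by
    intro z hz
    have h1 := hrb hz
    rw [h.iterate_eq] at h1
    have h2 := norm_add_le (f^[p] z - z₀ - (z - z₀) • deriv (f^[p]) z₀)
      ((z - z₀) • deriv (f^[p]) z₀)
    rw [sub_add_cancel, norm_smul] at h2
    nlinarith
  have hmaps : ∀ z ∈ Metric.closedBall z₀ r, f^[p] z ∈ Metric.ball z₀ r := by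
    intro z hz
    have h1 := hcontr z hz
    rw [Metric.mem_closedBall, dist_eq_norm] at hz
    rw [Metric.mem_ball, dist_eq_norm]
    nlinarith [norm_nonneg (z - z₀)]
  refine ⟨r, hr, hmaps, fun z hz => ?_⟩
  have hn : ∀ n : ℕ, f^[n * p] z ∈ Metric.closedBall z₀ r ∧ ‖f^[n * p] z - z₀‖ ≤ c ^ n * r := by
    intro n
    induction n with
    | zero => simpa [dist_eq_norm] using hz
    | succ n ih =>
      rw [add_mul, one_mul, add_comm, Function.iterate_add_apply]
      refine ⟨Metric.ball_subset_closedBall (hmaps _ ih.1), (hcontr _ ih.1).trans ?_⟩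
      rw [pow_succ]
      nlinarith [ih.2]
  rw [attractedSet, mem_ofPred_eq, tendsto_iff_norm_sub_tendsto_zero]
  refine squeeze_zero (fun _ => norm_nonneg _) (fun n => (hn n).2) ?_
  simpa using (tendsto_pow_atTop_nhds_zero_of_lt_one hc0 hc2).mul_const r

theorem IsAttractingPeriodicPt.isOpen_attractedSet (hf : Differentiable ℂ f)
    (h : IsAttractingPeriodicPt f p z₀) : IsOpen (attractedSet f p z₀) := by
  obtain ⟨r, hr, -, hr2⟩ := h.exists_trap hf
  rw [isOpen_iff_mem_nhds]
  intro z hz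
  obtain ⟨n, hn⟩ := (hz.eventually (Metric.ball_mem_nhds z₀ hr)).exists
  filter_upwards [(hf.continuous.iterate (n * p)).continuousAt.preimage_mem_nhds
    (Metric.isOpen_ball.mem_nhds hn)] with w hw
  exact mem_attractedSet_of_iterate n (hr2 (Metric.ball_subset_closedBall hw))

/-- Phase bookkeeping: a point that reaches the phase of `z₀` after `n ≡ -j` steps modulo `p` has
phase `j`. -/
theorem mem_attractedSet_of_iterate_mem (hf : Continuous f) {z : ℂ} {n j m : ℕ}
    (hz : f^[n] z ∈ attractedSet f p z₀) (hm : n + j = m * p) :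
    z ∈ attractedSet f p (f^[j] z₀) := by
  have h1 := iterate_mem_attractedSet hf hz j
  rw [← Function.iterate_add_apply, add_comm, hm] at h1
  exact mem_attractedSet_of_iterate m h1

theorem IsAttractingPeriodicPt.iterate_mem_of_mem_attractedSet (hf : Continuous f)
    (h : IsAttractingPeriodicPt f p z₀) {z : ℂ} {j : ℕ} (hj : j ≤ p)
    (hz : z ∈ attractedSet f p (f^[j] z₀)) : f^[p - j] z ∈ attractedSet f p z₀ := by
  have h1 := iterate_mem_attractedSet hf hz (p - j)
  rwa [← Function.iterate_add_apply, Nat.sub_add_cancel hj, h.iterate_eq] at h1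

theorem IsAttractingPeriodicPt.isOpen_attractedSet_iterate (hf : Differentiable ℂ f)
    (h : IsAttractingPeriodicPt f p z₀) {j : ℕ} (hj : j ≤ p) :
    IsOpen (attractedSet f p (f^[j] z₀)) := by
  have : attractedSet f p (f^[j] z₀) = f^[p - j] ⁻¹' attractedSet f p z₀ := by
    ext z
    refine ⟨h.iterate_mem_of_mem_attractedSet hf.continuous hj, fun hz => ?_⟩
    exact mem_attractedSet_of_iterate_mem hf.continuous hz (m := 1)
      (by rw [one_mul, Nat.sub_add_cancel hj])
  rw [this]
  exact (h.isOpen_attractedSet hf).preimage (hf.continuous.iterate _)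

theorem mem_cycleBasin_iff_attractedSet {z : ℂ} :
    z ∈ cycleBasin f p z₀ ↔ ∃ j < p, z ∈ attractedSet f p (f^[j] z₀) := Iff.rfl

theorem IsAttractingPeriodicPt.mem_cycleBasin_iff (hf : Continuous f)
    (h : IsAttractingPeriodicPt f p z₀) {z : ℂ} :
    z ∈ cycleBasin f p z₀ ↔ ∃ n, f^[n] z ∈ attractedSet f p z₀ := by
  constructor
  · rintro ⟨j, hj, hz⟩
    exact ⟨p - j, h.iterate_mem_of_mem_attractedSet hf hj.le hz⟩
  · rintro ⟨n, hn⟩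
    have hp := h.1
    rcases Nat.eq_zero_or_pos (n % p) with h0 | h0
    · exact ⟨0, hp, mem_attractedSet_of_iterate_mem hf hn (m := n / p) (by
        have := Nat.div_add_mod n p
        rw [mul_comm]; omega)⟩
    · refine ⟨p - n % p, by omega, mem_attractedSet_of_iterate_mem hf hn (m := n / p + 1) ?_⟩
      have h1 := Nat.div_add_mod n p
      have h2 := Nat.mod_lt n hp
      rw [add_mul, one_mul, mul_comm]; omega

theorem IsAttractingPeriodicPt.map_mem_cycleBasin_iff (hf : Continuous f)
    (h : IsAttractingPeriodicPt f p z₀) {z : ℂ} :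
    f z ∈ cycleBasin f p z₀ ↔ z ∈ cycleBasin f p z₀ := by
  rw [h.mem_cycleBasin_iff hf, h.mem_cycleBasin_iff hf]
  constructor
  · rintro ⟨n, hn⟩
    exact ⟨n + 1, by rwa [Function.iterate_succ_apply]⟩
  · rintro ⟨n, hn⟩
    have h1 := iterate_mul_mem_attractedSet 1 hn
    rw [one_mul, ← Function.iterate_add_apply] at h1
    obtain ⟨k, hk⟩ : ∃ k, p + n = k + 1 := ⟨p + n - 1, by have := h.1; omega⟩
    exact ⟨k, by rwa [← Function.iterate_succ_apply, Nat.succ_eq_add_one, ← hk]⟩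

theorem IsAttractingPeriodicPt.iterate_mem_cycleBasin_iff (hf : Continuous f)
    (h : IsAttractingPeriodicPt f p z₀) {z : ℂ} (n : ℕ) :
    f^[n] z ∈ cycleBasin f p z₀ ↔ z ∈ cycleBasin f p z₀ := by
  induction n with
  | zero => rfl
  | succ n ih => rw [Function.iterate_succ_apply', h.map_mem_cycleBasin_iff hf, ih]

theorem IsAttractingPeriodicPt.isOpen_cycleBasin (hf : Differentiable ℂ f)
    (h : IsAttractingPeriodicPt f p z₀) : IsOpen (cycleBasin f p z₀) := by
  have : cycleBasin f p z₀ = ⋃ j ∈ Finset.range p, attractedSet f p (f^[j] z₀) := by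
    ext z; simp [mem_cycleBasin_iff_attractedSet]
  rw [this]
  exact isOpen_biUnion fun j hj =>
    h.isOpen_attractedSet_iterate hf (Finset.mem_range.1 hj).le

theorem IsAttractingPeriodicPt.self_mem_attractedSet (h : IsAttractingPeriodicPt f p z₀) :
    z₀ ∈ attractedSet f p z₀ := by
  refine tendsto_const_nhds.congr fun n => ?_
  rw [mul_comm, Function.iterate_mul, Function.iterate_fixed h.iterate_eq]

theorem IsAttractingPeriodicPt.iterate_mem_cycleBasin (hf : Continuous f)
    (h : IsAttractingPeriodicPt f p z₀) (j : ℕ) : f^[j] z₀ ∈ cycleBasin f p z₀ :=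
  (h.iterate_mem_cycleBasin_iff hf j).2 ⟨0, h.1, h.self_mem_attractedSet⟩

theorem IsAttractingPeriodicPt.mem_basinComponent (hf : Continuous f)
    (h : IsAttractingPeriodicPt f p z₀) (j : ℕ) : f^[j] z₀ ∈ basinComponent f p z₀ j :=
  mem_connectedComponentIn (h.iterate_mem_cycleBasin hf j)

theorem IsAttractingPeriodicPt.isOpen_basinComponent (hf : Differentiable ℂ f)
    (h : IsAttractingPeriodicPt f p z₀) (j : ℕ) : IsOpen (basinComponent f p z₀ j) :=
  (h.isOpen_cycleBasin hf).connectedComponentIn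

theorem isPreconnected_basinComponent (j : ℕ) : IsPreconnected (basinComponent f p z₀ j) :=
  isPreconnected_connectedComponentIn

theorem basinComponent_subset_cycleBasin (j : ℕ) :
    basinComponent f p z₀ j ⊆ cycleBasin f p z₀ := connectedComponentIn_subset _ _

theorem IsAttractingPeriodicPt.basinComponent_period (h : IsAttractingPeriodicPt f p z₀) :
    basinComponent f p z₀ p = basinComponent f p z₀ 0 := by
  simp only [basinComponent, h.iterate_eq, Function.iterate_zero, id]

/-- The attracted sets of the `p` cycle points are open, pairwise disjoint and cover the basin, so a
connected part of the basin lies in one of them. -/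
theorem IsAttractingPeriodicPt.basinComponent_subset_attractedSet (hf : Differentiable ℂ f)
    (h : IsAttractingPeriodicPt f p z₀) {j : ℕ} (hj : j < p) :
    basinComponent f p z₀ j ⊆ attractedSet f p (f^[j] z₀) := by
  have hself : f^[j] z₀ ∈ attractedSet f p (f^[j] z₀) :=
    iterate_mem_attractedSet hf.continuous h.self_mem_attractedSet j
  refine (isPreconnected_basinComponent j).subset_left_of_subset_union
    (h.isOpen_attractedSet_iterate hf hj.le)
    (v := ⋃ i ∈ (Finset.range p).erase j, attractedSet f p (f^[i] z₀)) ?_ ?_ ?_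
    ⟨_, h.mem_basinComponent hf.continuous j, hself⟩
  · exact isOpen_biUnion fun i hi =>
      h.isOpen_attractedSet_iterate hf (Finset.mem_range.1 (Finset.mem_of_mem_erase hi)).le
  · rw [disjoint_left]
    intro z hz hz'
    simp only [mem_iUnion] at hz'
    obtain ⟨i, hi, hzi⟩ := hz'
    rw [Finset.mem_erase, Finset.mem_range] at hi
    exact hi.1 (h.iterate_inj hi.2 hj (tendsto_nhds_unique hzi hz))
  · intro z hz
    obtain ⟨i, hi, hzi⟩ := basinComponent_subset_cycleBasin j hz
    by_cases hij : i = j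
    · exact Or.inl (hij ▸ hzi)
    · right
      simp only [mem_iUnion]
      exact ⟨i, by simp [hij, hi], hzi⟩

theorem IsAttractingPeriodicPt.disjoint_basinComponent (hf : Differentiable ℂ f)
    (h : IsAttractingPeriodicPt f p z₀) {i j : ℕ} (hi : i < p) (hj : j < p) (hij : i ≠ j) :
    Disjoint (basinComponent f p z₀ i) (basinComponent f p z₀ j) := by
  rw [disjoint_left]
  intro z h1 h2
  exact hij (h.iterate_inj hi hj (tendsto_nhds_unique
    (h.basinComponent_subset_attractedSet hf hi h1)
    (h.basinComponent_subset_attractedSet hf hj h2)))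

theorem IsAttractingPeriodicPt.subset_basinComponent (hf : Continuous f)
    (h : IsAttractingPeriodicPt f p z₀) {j : ℕ} {S : Set ℂ} (hS : IsPreconnected S)
    (hj : f^[j] z₀ ∈ S) (hSb : f '' S ⊆ cycleBasin f p z₀) : S ⊆ basinComponent f p z₀ j :=
  hS.subset_connectedComponentIn hj fun _ hz =>
    (h.map_mem_cycleBasin_iff hf).1 (hSb (mem_image_of_mem f hz))

theorem IsAttractingPeriodicPt.mapsTo_basinComponent (hf : Continuous f)
    (h : IsAttractingPeriodicPt f p z₀) (j : ℕ) :
    MapsTo f (basinComponent f p z₀ j) (basinComponent f p z₀ (j + 1)) := by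
  rw [mapsTo_iff_image_subset]
  refine ((isPreconnected_basinComponent j).image f hf.continuousOn).subset_connectedComponentIn
    ⟨_, h.mem_basinComponent hf j, (Function.iterate_succ_apply' f j z₀).symm⟩ ?_
  rintro _ ⟨z, hz, rfl⟩
  exact (h.map_mem_cycleBasin_iff hf).2 (basinComponent_subset_cycleBasin j hz)

/-- The basin is completely invariant. This lets results on components of preimages under the
exponential map apply to the `U_j`. -/
theorem IsAttractingPeriodicPt.connectedComponentIn_preimage (hf : Continuous f)
    (h : IsAttractingPeriodicPt f p z₀) (j : ℕ) :
    connectedComponentIn (f ⁻¹' basinComponent f p z₀ (j + 1)) (f^[j] z₀) =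
      basinComponent f p z₀ j := by
  have hm := h.mapsTo_basinComponent hf j
  refine Subset.antisymm ?_ ?_
  · refine h.subset_basinComponent hf isPreconnected_connectedComponentIn
      (mem_connectedComponentIn (hm (h.mem_basinComponent hf j))) ?_
    rintro _ ⟨z, hz, rfl⟩
    exact basinComponent_subset_cycleBasin _
      (connectedComponentIn_subset (f ⁻¹' basinComponent f p z₀ (j + 1)) _ hz)
  · exact (isPreconnected_basinComponent j).subset_connectedComponentIn
      (h.mem_basinComponent hf j) hm

/-- A small disc falls into the trap after finitely many steps, so all its iterates lie in one
compact set. They omit a disc outside it, and the normality criterion applies. -/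
theorem IsAttractingPeriodicPt.cycleBasin_subset_fatouSet (hf : Differentiable ℂ f)
    (h : IsAttractingPeriodicPt f p z₀) : cycleBasin f p z₀ ⊆ fatouSet f := by
  intro z hz
  obtain ⟨r, hr, hrm, -⟩ := h.exists_trap hf
  have hfc := hf.continuous
  obtain ⟨n, hn⟩ : ∃ n, f^[n] z ∈ Metric.ball z₀ r := by
    obtain ⟨n, hn⟩ := (h.mem_cycleBasin_iff hfc).1 hz
    obtain ⟨m, hm⟩ := (Tendsto.eventually hn (Metric.ball_mem_nhds z₀ hr)).exists
    exact ⟨m * p + n, by rwa [Function.iterate_add_apply]⟩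
  obtain ⟨δ, hδ, hδs⟩ := Metric.nhds_basis_closedBall.mem_iff.1
    ((hfc.iterate n).continuousAt.preimage_mem_nhds (Metric.isOpen_ball.mem_nhds hn))
  have htrap : ∀ q : ℕ, ∀ u ∈ Metric.closedBall z₀ r, f^[q * p] u ∈ Metric.closedBall z₀ r := by
    intro q u hu
    rw [mul_comm, Function.iterate_mul]
    exact MapsTo.iterate (fun z hz => Metric.ball_subset_closedBall (hrm z hz)) q hu
  set K : Set ℂ := (⋃ i ∈ Finset.range p, f^[i] '' Metric.closedBall z₀ r) ∪
    ⋃ i ∈ Finset.range n, f^[i] '' Metric.closedBall z δ with hK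
  have hKc : IsCompact K :=
    ((Finset.range p).isCompact_biUnion fun i _ =>
      (isCompact_closedBall z₀ r).image (hfc.iterate i)).union
    ((Finset.range n).isCompact_biUnion fun i _ =>
      (isCompact_closedBall z δ).image (hfc.iterate i))
  obtain ⟨R, hR⟩ := (Metric.isBounded_iff_subset_closedBall 0).1 hKc.isBounded
  have hmem : ∀ k, ∀ w ∈ Metric.ball z δ, f^[k] w ∈ K := by
    intro k w hw
    have hw' := Metric.ball_subset_closedBall hw
    rcases lt_or_ge k n with hk | hk
    · right
      simp only [mem_iUnion]
      exact ⟨k, by simpa using hk, w, hw', rfl⟩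
    · left
      simp only [mem_iUnion]
      refine ⟨(k - n) % p, by simpa using Nat.mod_lt _ h.1, f^[(k - n) / p * p] (f^[n] w),
        htrap _ _ (Metric.ball_subset_closedBall (hδs hw')), ?_⟩
      rw [← Function.iterate_add_apply, ← Function.iterate_add_apply]
      have := Nat.mod_add_div (k - n) p
      rw [mul_comm ((k - n) / p)]
      rw [this]
      congr 1
      omega
  refine mem_fatouSet_of_omits_ball (v := ((|R| + 2 : ℝ) : ℂ)) hf hδ one_pos fun k w hw hk => ?_
  have h1 := hR (hmem k w hw)
  rw [mem_closedBall_zero_iff] at h1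
  rw [Metric.mem_ball, dist_eq_norm] at hk
  have h2 := norm_sub_norm_le (((|R| + 2 : ℝ) : ℂ)) (f^[k] w)
  rw [norm_sub_rev, Complex.norm_real, Real.norm_eq_abs, abs_of_pos (by positivity)] at h2
  linarith [le_abs_self R]

/-- A limit of iterates `f^{np}` near a frontier point equals `z₀` on a part of `U_0`, hence
everywhere by the identity theorem, which would put the frontier point into the basin. Convergence
to `∞` is excluded on `U_0`. -/
theorem IsAttractingPeriodicPt.frontier_basinComponent_subset_juliaSet (hf : Differentiable ℂ f)
    (h : IsAttractingPeriodicPt f p z₀) :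
    frontier (basinComponent f p z₀ 0) ⊆ juliaSet f := by
  rintro z hz ⟨r, hr, hnorm⟩
  have hzb : z ∉ cycleBasin f p z₀ := fun hzb =>
    disjoint_left.1 (disjoint_frontier_connectedComponentIn (h.isOpen_cycleBasin hf) _) hz hzb
  obtain ⟨y, hyr, hyU⟩ := mem_closure_iff.1 hz.1 _ Metric.isOpen_ball (Metric.mem_ball_self hr)
  have hU : ∀ w ∈ basinComponent f p z₀ 0, Tendsto (fun n : ℕ => f^[n * p] w) atTop (𝓝 z₀) :=
    fun w hw => h.basinComponent_subset_attractedSet hf h.1 hw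
  obtain ⟨φ, hφ, ⟨g, hg⟩ | hinf⟩ := hnorm fun n => n * p
  · have hgd : DifferentiableOn ℂ g (Metric.ball z r) :=
      hg.differentiableOn (Eventually.of_forall fun m => (hf.iterate _).differentiableOn)
        Metric.isOpen_ball
    have heq : ∀ᶠ w in 𝓝 y, g w = z₀ := by
      filter_upwards [Metric.isOpen_ball.mem_nhds hyr,
        (h.isOpen_basinComponent hf 0).mem_nhds hyU] with w hwr hwU
      exact tendsto_nhds_unique (hg.tendsto_at hwr) ((hU w hwU).comp hφ.tendsto_atTop)
    have hgz : g z = z₀ :=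
      (hgd.analyticOnNhd Metric.isOpen_ball).eqOn_of_preconnected_of_eventuallyEq
        (g := fun _ => z₀) analyticOnNhd_const Metric.isPreconnected_ball hyr heq
        (Metric.mem_ball_self hr)
    have hlim := hg.tendsto_at (Metric.mem_ball_self hr)
    rw [hgz] at hlim
    obtain ⟨m, hm⟩ := (hlim.eventually
      ((h.isOpen_attractedSet hf).mem_nhds h.self_mem_attractedSet)).exists
    exact hzb ((h.mem_cycleBasin_iff hf.continuous).2 ⟨_, hm⟩)
  · have h1 := hinf {y} (by simpa using hyr) isCompact_singleton (‖z₀‖ + 1)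
    have h2 := (((hU y hyU).comp hφ.tendsto_atTop).norm).eventually
      (gt_mem_nhds (lt_add_one ‖z₀‖))
    obtain ⟨m, hm1, hm2⟩ := (h1.and h2).exists
    have := hm1 y rfl
    simp only [Function.comp_apply] at hm2
    linarith

/-- A compact subset of a basin component does not separate other basin points from `∞`. -/
theorem IsAttractingPeriodicPt.mem_attractedSet_of_isBounded (hf : Differentiable ℂ f)
    (h : IsAttractingPeriodicPt f p z₀) {j : ℕ} (hj : j ≤ p) {Γ : Set ℂ} (hΓ : IsCompact Γ)
    (hΓj : Γ ⊆ attractedSet f p (f^[j] z₀)) {x : ℂ} (hx : x ∉ Γ)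
    (hb : Bornology.IsBounded (connectedComponentIn Γᶜ x)) :
    x ∈ attractedSet f p (f^[j] z₀) := by
  obtain ⟨r, hr, hrm, hra⟩ := h.exists_trap hf
  have hfc := hf.continuous
  -- These sets increase because `f^p` maps the trap into itself, so by compactness one of them
  -- contains `Γ`.
  let O : ℕ → Set ℂ := fun n => f^[n * p + (p - j)] ⁻¹' Metric.ball z₀ r
  have hOo : ∀ n, IsOpen (O n) := fun n => Metric.isOpen_ball.preimage (hfc.iterate _)
  have hOm : Monotone O := by
    refine monotone_nat_of_le_succ fun n z hz => ?_
    have h1 := hrm _ (Metric.ball_subset_closedBall hz)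
    rw [← Function.iterate_add_apply] at h1
    have : p + (n * p + (p - j)) = (n + 1) * p + (p - j) := by ring
    rwa [this] at h1
  obtain ⟨n, hn⟩ := hΓ.elim_directed_cover O hOo (by
    intro z hz
    have h1 := h.iterate_mem_of_mem_attractedSet hfc hj (hΓj hz)
    obtain ⟨n, hn⟩ := (Tendsto.eventually h1 (Metric.ball_mem_nhds z₀ hr)).exists
    refine mem_iUnion.2 ⟨n, ?_⟩
    rwa [← Function.iterate_add_apply] at hn) hOm.directed_le
  have hfr : frontier (connectedComponentIn Γᶜ x) ⊆ Γ := by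
    intro y hy
    by_contra hyΓ
    exact disjoint_left.1
      (disjoint_frontier_connectedComponentIn hΓ.isClosed.isOpen_compl x) hy hyΓ
  -- Maximum principle on the bounded component, whose frontier lies in `Γ`.
  have h2 : ‖f^[n * p + (p - j)] x - z₀‖ ≤ r := by
    refine Complex.norm_le_of_forall_mem_frontier_norm_le hb
      (f := fun z => f^[n * p + (p - j)] z - z₀)
      ((hf.iterate _).sub_const z₀).diffContOnCl (fun y hy => ?_)
      (subset_closure (mem_connectedComponentIn hx))
    have := hn (hfr hy)
    rw [mem_preimage, Metric.mem_ball, dist_eq_norm] at this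
    exact this.le
  refine mem_attractedSet_of_iterate_mem hfc (n := n * p + (p - j)) (m := n + 1)
    (hra (by rwa [Metric.mem_closedBall, dist_eq_norm])) ?_
  rw [add_assoc, Nat.sub_add_cancel hj]; ring

end Basin

/-! ### Basin components of the exponential map -/

section ExpBasin

variable {lam : ℂ} {p : ℕ} {z₀ : ℂ}

theorem IsAttractingPeriodicPt.disjoint_basinComponent_one
    (h : IsAttractingPeriodicPt (expMap lam) p z₀) (hp : 1 < p) {j : ℕ} (hj : 1 ≤ j) (hjp : j < p) :
    Disjoint (basinComponent (expMap lam) p z₀ 1) (basinComponent (expMap lam) p z₀ (j + 1)) := by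
  rcases Nat.lt_or_ge (j + 1) p with hlt | hge
  · exact h.disjoint_basinComponent (differentiable_expMap lam) hp hlt (by omega)
  · obtain rfl : j + 1 = p := by omega
    rw [h.basinComponent_period]
    exact h.disjoint_basinComponent (differentiable_expMap lam) hp h.1 one_ne_zero

theorem IsAttractingPeriodicPt.basinComponent_succ_subset_attractedSet
    (h : IsAttractingPeriodicPt (expMap lam) p z₀) {j : ℕ} (hjp : j < p) :
    basinComponent (expMap lam) p z₀ (j + 1) ⊆
      attractedSet (expMap lam) p ((expMap lam)^[j + 1] z₀) := by
  rcases Nat.lt_or_ge (j + 1) p with hlt | hge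
  · exact h.basinComponent_subset_attractedSet (differentiable_expMap lam) hlt
  · obtain rfl : j + 1 = p := by omega
    rw [h.basinComponent_period, h.iterate_eq]
    exact h.basinComponent_subset_attractedSet (differentiable_expMap lam) h.1

/-- On the basin components other than `U_0` the exponential map is injective and has a continuous
inverse. -/
theorem IsAttractingPeriodicPt.exists_inverse_basinComponent (hlam : lam ≠ 0)
    (h : IsAttractingPeriodicPt (expMap lam) p z₀) (hp : 1 < p)
    (h0 : (0 : ℂ) ∈ basinComponent (expMap lam) p z₀ 1) {j : ℕ} (hj : 1 ≤ j) (hjp : j < p) :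
    ∃ l : ℂ → ℂ, ContinuousOn l (basinComponent (expMap lam) p z₀ (j + 1)) ∧
      (∀ u ∈ basinComponent (expMap lam) p z₀ (j + 1),
        l u ∈ basinComponent (expMap lam) p z₀ j ∧ expMap lam (l u) = u) ∧
      ∀ y ∈ basinComponent (expMap lam) p z₀ j, l (expMap lam y) = y := by
  have hf := differentiable_expMap lam
  have hfc := hf.continuous
  have hd := h.disjoint_basinComponent_one hp hj hjp
  have h0' := disjoint_left.1 hd h0
  have hx : expMap lam ((expMap lam)^[j] z₀) ∈ basinComponent (expMap lam) p z₀ (j + 1) :=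
    h.mapsTo_basinComponent hfc j (h.mem_basinComponent hfc j)
  have hinv := exists_inverse_expMap hlam (h.isOpen_basinComponent hf (j + 1))
    (isPreconnected_basinComponent _) h0' hx
  rw [h.connectedComponentIn_preimage hfc] at hinv
  refine hinv fun y s hy hys => ?_
  -- Two such points would give a compact set in `U_{j+1}` separating 0 from `∞`. Then 0 would be
  -- attracted to `z_{j+1}` as well as to `z_1`.
  by_contra hs
  rw [← h.connectedComponentIn_preimage hfc] at hy hys
  obtain ⟨Γ, hΓG, hΓ, hW⟩ :=
    exists_isCompact_of_translate_mem (h.isOpen_basinComponent hf (j + 1)) hs hy hys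
  have h0Γ : (0 : ℂ) ∉ Γ := fun hc => h0' (hΓG hc)
  have hb := hW (connectedComponentIn Γᶜ 0) isPreconnected_connectedComponentIn
    (mem_connectedComponentIn h0Γ)
    (disjoint_left.2 fun u hu hu' => connectedComponentIn_subset _ _ hu' hu)
  have h1 := h.mem_attractedSet_of_isBounded hf (j := j + 1) hjp hΓ
    (hΓG.trans (h.basinComponent_succ_subset_attractedSet hjp)) h0Γ hb
  have h2 := h.basinComponent_subset_attractedSet hf hp h0
  have h3 := tendsto_nhds_unique h1 h2
  rcases Nat.lt_or_ge (j + 1) p with hlt | hge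
  · have := h.iterate_inj hlt hp h3; omega
  · have hjp' : j + 1 = p := by omega
    rw [hjp', h.iterate_eq] at h3
    have := h.iterate_inj h.1 hp (h3 : (expMap lam)^[0] z₀ = _)
    omega

/-- Because `0 ∈ U_1`, the preimage of `U_1` is connected, and it contains `z_0`. -/
theorem IsAttractingPeriodicPt.preimage_basinComponent_one (hlam : lam ≠ 0)
    (h : IsAttractingPeriodicPt (expMap lam) p z₀)
    (h0 : (0 : ℂ) ∈ basinComponent (expMap lam) p z₀ 1) :
    expMap lam ⁻¹' basinComponent (expMap lam) p z₀ 1 ⊆ basinComponent (expMap lam) p z₀ 0 := by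
  have hf := differentiable_expMap lam
  intro y hy
  rw [← h.connectedComponentIn_preimage hf.continuous]
  exact mem_connectedComponentIn_preimage_expMap hlam (h.isOpen_basinComponent hf 1)
    (isPreconnected_basinComponent _) h0
    (h.mapsTo_basinComponent hf.continuous 0 (h.mem_basinComponent hf.continuous 0)) hy

end ExpBasin

/-! ### The absorbing domain -/

theorem IsPreconnected.subset_of_disjoint_frontier {S B : Set ℂ} (hS : IsPreconnected S)
    (hB : IsOpen B) (hd : Disjoint S (frontier B)) (hne : (S ∩ B).Nonempty) : S ⊆ B := by
  refine hS.subset_left_of_subset_union hB isClosed_closure.isOpen_compl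
    (disjoint_compl_right.mono_left subset_closure) (fun x hx => ?_) hne
  by_cases h : x ∈ closure B
  · left
    by_contra hxB
    exact disjoint_left.1 hd hx (by rw [hB.frontier_eq]; exact ⟨h, hxB⟩)
  · exact Or.inr h

theorem isClosed_connectedComponentIn {S : Set ℂ} (hS : IsClosed S) (x : ℂ) :
    IsClosed (connectedComponentIn S x) := by
  by_cases hx : x ∈ S
  · refine isClosed_of_closure_subset ?_
    exact isPreconnected_connectedComponentIn.closure.subset_connectedComponentIn
      (subset_closure (mem_connectedComponentIn hx))
      (closure_minimal (connectedComponentIn_subset S x) hS)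
  · rw [connectedComponentIn_eq_empty hx]
    exact isClosed_empty

section Absorbing

variable {lam : ℂ} {p : ℕ} {z₀ : ℂ} {B : Set ℂ}

theorem IsAbsorbingDomain.closure_subset (hB : IsAbsorbingDomain (expMap lam) p z₀ B) :
    closure B ⊆ basinComponent (expMap lam) p z₀ 1 := by
  rw [closure_eq_self_union_frontier]
  exact union_subset hB.subset hB.frontier_subset

theorem IsAbsorbingDomain.isPreconnected (hB : IsAbsorbingDomain (expMap lam) p z₀ B) :
    IsPreconnected B :=
  hB.simplyConnected.isPathConnected.isConnected.isPreconnected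

theorem IsAttractingPeriodicPt.exists_halfPlane_subset (hlam : lam ≠ 0)
    (h : IsAttractingPeriodicPt (expMap lam) p z₀)
    (h0 : (0 : ℂ) ∈ basinComponent (expMap lam) p z₀ 1) :
    ∃ c : ℝ, {z : ℂ | z.re < c} ⊆ basinComponent (expMap lam) p z₀ 0 := by
  obtain ⟨δ, hδ, hball⟩ := Metric.isOpen_iff.1
    (h.isOpen_basinComponent (differentiable_expMap lam) 1) 0 h0
  have hl : 0 < ‖lam‖ := norm_pos_iff.2 hlam
  refine ⟨Real.log (δ / ‖lam‖), fun z hz => h.preimage_basinComponent_one hlam h0 (hball ?_)⟩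
  rw [mem_ball_zero_iff, expMap, norm_mul, Complex.norm_exp]
  have : Real.exp z.re < δ / ‖lam‖ := by
    rw [← Real.exp_log (show 0 < δ / ‖lam‖ by positivity)]
    exact Real.exp_lt_exp.2 hz
  rw [lt_div_iff₀ hl] at this
  linarith

/-- An unbounded `B` with compact frontier would contain a large circle about 0. This circle enters
the left half-plane contained in `U_0`, which is disjoint from `U_1`. -/
theorem IsAbsorbingDomain.isCompact_closure (hB : IsAbsorbingDomain (expMap lam) p z₀ B)
    (hlam : lam ≠ 0) (h : IsAttractingPeriodicPt (expMap lam) p z₀) (hp : 1 < p)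
    (h0 : (0 : ℂ) ∈ basinComponent (expMap lam) p z₀ 1) : IsCompact (closure B) := by
  refine Metric.isCompact_of_isClosed_isBounded isClosed_closure ?_
  rw [Metric.isBounded_closure_iff]
  by_contra hunb
  obtain ⟨γ, hγ, hγr⟩ := hB.frontier_jordan
  have hfc : IsCompact (frontier B) := hγr ▸ isCompact_range hγ.continuous
  obtain ⟨R, hR⟩ := (Metric.isBounded_iff_subset_closedBall 0).1 hfc.isBounded
  obtain ⟨c, hc⟩ := h.exists_halfPlane_subset hlam h0
  obtain ⟨b, hb, hbR⟩ : ∃ b ∈ B, |R| + |c| + 1 < ‖b‖ := by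
    by_contra! hcon
    exact hunb ((Metric.isBounded_iff_subset_closedBall 0).2 ⟨_, fun y hy => by
      simpa using hcon y hy⟩)
  have hS : Metric.sphere (0 : ℂ) ‖b‖ ⊆ B := by
    refine (isPreconnected_sphere (by rw [Complex.rank_real_complex]; norm_num) 0
      ‖b‖).subset_of_disjoint_frontier hB.isOpen ?_ ⟨b, by simp, hb⟩
    rw [disjoint_left]
    intro y hy hyB
    have h1 := hR hyB
    rw [mem_closedBall_zero_iff] at h1
    rw [mem_sphere_zero_iff_norm] at hy
    linarith [le_abs_self R, abs_nonneg c]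
  have h1 : ((-‖b‖ : ℝ) : ℂ) ∈ B := hS (by simp)
  have h2 : ((-‖b‖ : ℝ) : ℂ) ∈ basinComponent (expMap lam) p z₀ 0 := hc (by
    simp only [mem_ofPred_eq, Complex.ofReal_re]
    linarith [neg_abs_le c, abs_nonneg R])
  exact disjoint_left.1 (h.disjoint_basinComponent (differentiable_expMap lam) hp h.1 one_ne_zero)
    (hB.subset h1) h2

theorem IsAbsorbingDomain.iterate_mem (hB : IsAbsorbingDomain (expMap lam) p z₀ B) {b : ℂ}
    (hb : b ∈ closure B) : (expMap lam)^[p] b ∈ B :=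
  hB.maps_into (image_closure_subset_closure_image ((continuous_expMap lam).iterate p)
    (mem_image_of_mem _ hb))

end Absorbing

/-! ### The domains `C_j` and the complement of `C_0` -/

section Domains

variable {lam : ℂ} {p : ℕ} {z₀ : ℂ} {B C : Set ℂ} {L₁ : ℝ}

theorem IsTruncatedDomain.closure_subset (hC : IsTruncatedDomain (expMap lam) z₀ B L₁ C)
    (hB : IsAbsorbingDomain (expMap lam) p z₀ B) (h : IsAttractingPeriodicPt (expMap lam) p z₀) :
    closure C ⊆ basinComponent (expMap lam) p z₀ 0 := by
  have hfc := continuous_expMap lam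
  refine h.subset_basinComponent hfc hC.isConnected.isPreconnected.closure
    (subset_closure hC.cycle_mem) ?_
  rintro _ ⟨z, hz, rfl⟩
  refine basinComponent_subset_cycleBasin 1 (hB.closure_subset ?_)
  exact (closure_minimal (fun y hy => subset_closure (hC.subset hy))
    (isClosed_closure.preimage hfc) : closure C ⊆ expMap lam ⁻¹' closure B) hz

/-- This is where `L₁` must be large. The image is connected, contains `z₀`, and stays in the strip
where `C` and `f⁻¹(B)` have the same frontier; as `f` maps it into `B`, it cannot cross that
frontier. -/
theorem IsTruncatedDomain.image_subset (hC : IsTruncatedDomain (expMap lam) z₀ B L₁ C)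
    (hB : IsAbsorbingDomain (expMap lam) p z₀ B) (h : IsAttractingPeriodicPt (expMap lam) p z₀)
    (hL : ∀ b ∈ closure B, |((expMap lam)^[p - 1] b).im| < L₁) :
    (expMap lam)^[p - 1] '' closure B ⊆ C := by
  have hfc := continuous_expMap lam
  have hp := h.1
  refine (hB.isPreconnected.closure.image _
    (hfc.iterate (p - 1)).continuousOn).subset_of_disjoint_frontier hC.isOpen ?_
    ⟨z₀, ⟨expMap lam z₀, subset_closure hB.cycle_mem, ?_⟩, hC.cycle_mem⟩
  · rw [disjoint_left]
    rintro _ ⟨b, hb, rfl⟩ hfr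
    rw [hC.frontier_eq _ (hL b hb), (hB.isOpen.preimage hfc).frontier_eq] at hfr
    refine hfr.2 ?_
    rw [mem_preimage, ← Function.iterate_succ_apply' (expMap lam), Nat.succ_eq_add_one, Nat.sub_add_cancel hp]
    exact hB.iterate_mem hb
  · rw [← Function.iterate_succ_apply, Nat.succ_eq_add_one, Nat.sub_add_cancel hp, h.iterate_eq]

theorem cycleDomain_period {f : ℂ → ℂ} : cycleDomain f p z₀ C p = C := by
  simp [cycleDomain, pulledBackDomain]

theorem cycleDomain_of_lt {f : ℂ → ℂ} {j : ℕ} (hj : j < p) :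
    cycleDomain f p z₀ C j =
      connectedComponentIn (f ⁻¹' cycleDomain f p z₀ C (j + 1)) (f^[j] z₀) := by
  have h1 : p - j = (p - (j + 1)) + 1 := by omega
  have h2 : p - (p - (j + 1) + 1) = j := by omega
  rw [cycleDomain, h1, pulledBackDomain, h2, cycleDomain]

theorem isOpen_cycleDomain (hC : IsOpen C) {j : ℕ} (hj : j ≤ p) :
    IsOpen (cycleDomain (expMap lam) p z₀ C j) := by
  induction hj using Nat.decreasingInduction with
  | self => rwa [cycleDomain_period]
  | of_succ j hj ih =>
    rw [cycleDomain_of_lt hj]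
    exact (ih.preimage (continuous_expMap lam)).connectedComponentIn

theorem mapsTo_cycleDomain {f : ℂ → ℂ} {j : ℕ} (hj : j < p) :
    MapsTo f (cycleDomain f p z₀ C j) (cycleDomain f p z₀ C (j + 1)) := by
  rw [cycleDomain_of_lt hj]
  exact fun z hz => connectedComponentIn_subset (f ⁻¹' cycleDomain f p z₀ C (j + 1)) _ hz

theorem mem_cycleDomain {f : ℂ → ℂ} (h : IsAttractingPeriodicPt f p z₀) (hC : z₀ ∈ C) {j : ℕ}
    (hj : j ≤ p) : f^[j] z₀ ∈ cycleDomain f p z₀ C j := by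
  induction hj using Nat.decreasingInduction with
  | self => rwa [cycleDomain_period, h.iterate_eq]
  | of_succ j hj ih =>
    rw [cycleDomain_of_lt hj]
    exact mem_connectedComponentIn (by rwa [mem_preimage, ← Function.iterate_succ_apply' f])

theorem isPreconnected_cycleDomain {f : ℂ → ℂ} (hC : IsPreconnected C) {j : ℕ} (hj : j ≤ p) :
    IsPreconnected (cycleDomain f p z₀ C j) := by
  rcases hj.lt_or_eq with hlt | rfl
  · rw [cycleDomain_of_lt hlt]; exact isPreconnected_connectedComponentIn
  · rwa [cycleDomain_period]

theorem IsTruncatedDomain.cycleDomain_subset (hC : IsTruncatedDomain (expMap lam) z₀ B L₁ C)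
    (hB : IsAbsorbingDomain (expMap lam) p z₀ B) (h : IsAttractingPeriodicPt (expMap lam) p z₀)
    {j : ℕ} (hj : j ≤ p) :
    cycleDomain (expMap lam) p z₀ C j ⊆ basinComponent (expMap lam) p z₀ j := by
  induction hj using Nat.decreasingInduction with
  | self =>
    rw [cycleDomain_period, h.basinComponent_period]
    exact subset_closure.trans (hC.closure_subset hB h)
  | of_succ j hj ih =>
    refine h.subset_basinComponent (continuous_expMap lam)
      (isPreconnected_cycleDomain hC.isConnected.isPreconnected hj.le)
      (mem_cycleDomain h hC.cycle_mem hj.le) ?_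
    rintro _ ⟨z, hz, rfl⟩
    exact basinComponent_subset_cycleBasin _ (ih (mapsTo_cycleDomain hj hz))

/-- Pulled back from `f^{p-1}(B) ⊆ C_p` along the connected sets `f^j(B)`. The case `j = 0` puts the
singular value into `C_1`. -/
theorem IsTruncatedDomain.iterate_mem_cycleDomain
    (hC : IsTruncatedDomain (expMap lam) z₀ B L₁ C)
    (hB : IsAbsorbingDomain (expMap lam) p z₀ B) (h : IsAttractingPeriodicPt (expMap lam) p z₀)
    (hL : ∀ b ∈ closure B, |((expMap lam)^[p - 1] b).im| < L₁) {j : ℕ} (hj : j < p) {b : ℂ}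
    (hb : b ∈ B) : (expMap lam)^[j] b ∈ cycleDomain (expMap lam) p z₀ C (j + 1) := by
  obtain ⟨n, rfl⟩ : ∃ n, p = n + 1 := ⟨p - 1, by omega⟩
  have hj' : j ≤ n := by omega
  induction hj' using Nat.decreasingInduction generalizing b with
  | self =>
    rw [cycleDomain_period]
    exact hC.image_subset hB h hL ⟨b, subset_closure hb, rfl⟩
  | of_succ j hj' ih =>
    rw [cycleDomain_of_lt (by omega)]
    have hpre : IsPreconnected ((expMap lam)^[j] '' B) :=
      hB.isPreconnected.image _ ((continuous_expMap lam).iterate j).continuousOn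
    refine hpre.subset_connectedComponentIn
      ⟨expMap lam z₀, hB.cycle_mem, (Function.iterate_succ_apply _ _ _).symm⟩ ?_ ⟨b, hb, rfl⟩
    rintro _ ⟨y, hy, rfl⟩
    rw [mem_preimage, ← Function.iterate_succ_apply' (expMap lam)]
    exact ih hy (by omega)

/-- As `0 ∈ C_1`, the preimage of `C_1` has only one component. In particular `C_0` is invariant
under translation by `2πi`. -/
theorem IsTruncatedDomain.cycleDomain_zero (hC : IsTruncatedDomain (expMap lam) z₀ B L₁ C)
    (hB : IsAbsorbingDomain (expMap lam) p z₀ B) (hlam : lam ≠ 0)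
    (h : IsAttractingPeriodicPt (expMap lam) p z₀)
    (hL : ∀ b ∈ closure B, |((expMap lam)^[p - 1] b).im| < L₁) :
    cycleDomain (expMap lam) p z₀ C 0 = expMap lam ⁻¹' cycleDomain (expMap lam) p z₀ C 1 := by
  refine Subset.antisymm (mapsTo_cycleDomain h.1) fun z hz => ?_
  rw [cycleDomain_of_lt h.1]
  have h0 := hC.iterate_mem_cycleDomain hB h hL h.1 hB.zero_mem
  exact mem_connectedComponentIn_preimage_expMap hlam (isOpen_cycleDomain hC.isOpen h.1)
    (isPreconnected_cycleDomain hC.isConnected.isPreconnected h.1) h0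
    (mem_cycleDomain h hC.cycle_mem h.1) hz

theorem IsTruncatedDomain.subset_cycleDomain_zero (hC : IsTruncatedDomain (expMap lam) z₀ B L₁ C)
    (hB : IsAbsorbingDomain (expMap lam) p z₀ B) (hlam : lam ≠ 0)
    (h : IsAttractingPeriodicPt (expMap lam) p z₀)
    (hL : ∀ b ∈ closure B, |((expMap lam)^[p - 1] b).im| < L₁) :
    C ⊆ cycleDomain (expMap lam) p z₀ C 0 := by
  rw [hC.cycleDomain_zero hB hlam h hL]
  exact fun z hz => hC.iterate_mem_cycleDomain hB h hL h.1 (hC.subset hz)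

/-- A closed connected subset of `C` which joins a given point to `∞`. -/
theorem IsTruncatedDomain.exists_unbounded (hC : IsTruncatedDomain (expMap lam) z₀ B L₁ C)
    {q : ℂ} (hq : q ∈ C) :
    ∃ W ⊆ C, IsClosed W ∧ IsPreconnected W ∧ ¬ Bornology.IsBounded W ∧ q ∈ W := by
  obtain ⟨c, hc⟩ := hC.halfPlane
  have hpc := (hC.isOpen.isConnected_iff_isPathConnected).1 hC.isConnected
  have hray : (fun t : ℝ => (t : ℂ)) '' Iic (c - 1) ⊆ C := by
    rintro _ ⟨t, ht, rfl⟩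
    refine hc ?_
    simp only [mem_ofPred_eq, Complex.ofReal_re]
    have := mem_Iic.1 ht
    linarith
  obtain ⟨β, hβ⟩ := hpc.joinedIn q hq _ (hray ⟨c - 1, mem_Iic.2 le_rfl, rfl⟩)
  refine ⟨range β ∪ (fun t : ℝ => (t : ℂ)) '' Iic (c - 1), union_subset ?_ hray, ?_, ?_, ?_,
    Or.inl ⟨0, β.source⟩⟩
  · rintro _ ⟨t, rfl⟩
    exact hβ t
  · exact (isCompact_range β.continuous).isClosed.union
      (Complex.isometry_ofReal.isClosedEmbedding.isClosedMap _ isClosed_Iic)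
  · exact IsPreconnected.union _ ⟨1, β.target⟩ ⟨c - 1, mem_Iic.2 le_rfl, rfl⟩
      (isPreconnected_range β.continuous)
      (isPreconnected_Iic.image _ Complex.continuous_ofReal.continuousOn)
  · intro hb
    obtain ⟨R, hR⟩ := (Metric.isBounded_iff_subset_closedBall 0).1 (hb.subset subset_union_right)
    have h1 := hR ⟨-(|R| + |c| + 1), by
      rw [mem_Iic]; linarith [neg_abs_le c, abs_nonneg R], rfl⟩
    rw [mem_closedBall_zero_iff, Complex.norm_real, norm_neg, Real.norm_eq_abs,
      abs_of_pos (by positivity)] at h1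
    linarith [le_abs_self R, abs_nonneg c]

/-- The images of closed sets under a partial inverse of a continuous map are closed. -/
theorem isClosed_image_of_inverse {f l : ℂ → ℂ} (hf : Continuous f) {U X : Set ℂ} (hU : IsOpen U)
    (hl : ContinuousOn l U) (hfl : ∀ u ∈ U, f (l u) = u) (hX : IsClosed X) (hXU : X ⊆ U) :
    IsClosed (l '' X) := by
  refine isClosed_of_closure_subset fun y hy => ?_
  have hfy : f y ∈ X := by
    refine (closure_minimal ?_ (hX.preimage hf) : closure (l '' X) ⊆ f ⁻¹' X) hy
    rintro _ ⟨x, hx, rfl⟩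
    rwa [mem_preimage, hfl x (hXU hx)]
  refine ⟨f y, hfy, ?_⟩
  have hcont : Tendsto (l ∘ f) (𝓝[l '' X] y) (𝓝 (l (f y))) :=
    ((hl.continuousAt (hU.mem_nhds (hXU hfy))).comp hf.continuousAt).tendsto.mono_left
      nhdsWithin_le_nhds
  have hid : Tendsto (l ∘ f) (𝓝[l '' X] y) (𝓝 y) := by
    refine (tendsto_id.mono_left nhdsWithin_le_nhds).congr' ?_
    filter_upwards [self_mem_nhdsWithin] with w hw
    obtain ⟨x, hx, rfl⟩ := hw
    simp [hfl x (hXU hx)]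
  have := mem_closure_iff_nhdsWithin_neBot.1 hy
  exact tendsto_nhds_unique hcont hid

/-- The properties hold for `C_p` by its definition and are carried down to `C_1` by the inverse
branches `U_{j+1} → U_j`, which map closed subsets of `ℂ` lying in `U_{j+1}` to closed subsets of
`ℂ`. For `C_1` they yield a connected complement and a cut from 0 to `∞`. -/
theorem IsTruncatedDomain.cycleDomain_geometry (hC : IsTruncatedDomain (expMap lam) z₀ B L₁ C)
    (hB : IsAbsorbingDomain (expMap lam) p z₀ B) (hlam : lam ≠ 0)
    (h : IsAttractingPeriodicPt (expMap lam) p z₀) (hp : 1 < p)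
    (h0 : (0 : ℂ) ∈ basinComponent (expMap lam) p z₀ 1)
    (hL : ∀ b ∈ closure B, |((expMap lam)^[p - 1] b).im| < L₁) {j : ℕ} (hj : j < p) :
    closure (cycleDomain (expMap lam) p z₀ C (j + 1)) ⊆
        basinComponent (expMap lam) p z₀ (j + 1) ∧
      IsPreconnected (frontier (cycleDomain (expMap lam) p z₀ C (j + 1))) ∧
      (frontier (cycleDomain (expMap lam) p z₀ C (j + 1))).Nonempty ∧
      ∃ W ⊆ cycleDomain (expMap lam) p z₀ C (j + 1), IsClosed W ∧ IsPreconnected W ∧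
        ¬ Bornology.IsBounded W ∧ (expMap lam)^[j] 0 ∈ W := by
  have hf := differentiable_expMap lam
  have hfc := hf.continuous
  obtain ⟨n, rfl⟩ : ∃ n, p = n + 1 := ⟨p - 1, by omega⟩
  have hj' : j ≤ n := by omega
  induction hj' using Nat.decreasingInduction with
  | self =>
    rw [cycleDomain_period, h.basinComponent_period]
    obtain ⟨Γ, hΓ, hΓr, -, -⟩ := hC.frontier_line
    refine ⟨hC.closure_subset hB h, ?_, ?_, hC.exists_unbounded ?_⟩
    · rw [← hΓr]; exact isPreconnected_range hΓ.continuous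
    · rw [← hΓr]; exact range_nonempty Γ
    · exact hC.image_subset hB h hL ⟨0, subset_closure hB.zero_mem, rfl⟩
  | of_succ j hj' ih =>
    obtain ⟨hcl, hfp, hfn, W, hWC, hWc, hWp, hWb, hW0⟩ := ih (by omega)
    obtain ⟨l, hlc, hl, hlf⟩ := h.exists_inverse_basinComponent hlam hp h0
      (show 1 ≤ j + 1 by omega) (by omega)
    set f := expMap lam with hfdef
    set U := basinComponent f (n + 1) z₀ (j + 1) with hUdef
    set U' := basinComponent f (n + 1) z₀ (j + 1 + 1) with hU'def
    set D := cycleDomain f (n + 1) z₀ C (j + 1) with hD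
    set D' := cycleDomain f (n + 1) z₀ C (j + 1 + 1) with hD'
    have hU'o : IsOpen U' := h.isOpen_basinComponent hf _
    have hDU : D ⊆ U := hC.cycleDomain_subset hB h (by omega)
    have hD'U : D' ⊆ U' := hC.cycleDomain_subset hB h (by omega)
    have hDo : IsOpen D := isOpen_cycleDomain hC.isOpen (by omega)
    have hD'o : IsOpen D' := isOpen_cycleDomain hC.isOpen (by omega)
    have hmaps : MapsTo f D D' := mapsTo_cycleDomain (by omega)
    have hfl : ∀ u ∈ U', f (l u) = u := fun u hu => (hl u hu).2
    have hDl : D = l '' D' := by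
      refine Subset.antisymm (fun y hy => ⟨f y, hmaps hy, hlf y (hDU hy)⟩) ?_
      rw [hD, cycleDomain_of_lt (by omega)]
      have hz : f^[j + 1] z₀ ∈ D := mem_cycleDomain h hC.cycle_mem (by omega)
      refine ((isPreconnected_cycleDomain hC.isConnected.isPreconnected (by omega)).image l
        (hlc.mono hD'U)).subset_connectedComponentIn ⟨_, hmaps hz, hlf _ (hDU hz)⟩ ?_
      rintro _ ⟨u, hu, rfl⟩
      rwa [mem_preimage, hfl u (hD'U hu)]
    have hcl2 : closure D = l '' closure D' := by
      refine Subset.antisymm (closure_minimal ?_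
        (isClosed_image_of_inverse hfc hU'o hlc hfl isClosed_closure hcl)) ?_
      · rw [hDl]; exact image_mono subset_closure
      · rw [hDl]; exact (hlc.mono hcl).image_closure
    have hfr : frontier D = l '' frontier D' := by
      rw [hDo.frontier_eq, hD'o.frontier_eq, hcl2]
      ext y
      constructor
      · rintro ⟨⟨u, hu, rfl⟩, hy⟩
        exact ⟨u, ⟨hu, fun huD => hy (hDl ▸ ⟨u, huD, rfl⟩)⟩, rfl⟩
      · rintro ⟨u, ⟨hu, huD⟩, rfl⟩
        refine ⟨⟨u, hu, rfl⟩, fun hy => huD ?_⟩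
        have := hmaps hy
        rwa [hfl u (hcl hu)] at this
    have hfrU : frontier D' ⊆ U' := frontier_subset_closure.trans hcl
    have hWU : W ⊆ U' := hWC.trans hD'U
    refine ⟨?_, ?_, ?_, l '' W, ?_, ?_, ?_, ?_, ?_⟩
    · rw [hcl2]
      rintro _ ⟨u, hu, rfl⟩
      exact (hl u (hcl hu)).1
    · rw [hfr]; exact hfp.image l (hlc.mono hfrU)
    · rw [hfr]; exact hfn.image l
    · rw [hDl]; exact image_mono hWC
    · exact isClosed_image_of_inverse hfc hU'o hlc hfl hWc hWU
    · exact hWp.image l (hlc.mono hWU)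
    -- A bounded `l '' W` would be compact, being closed, and `f` maps it onto `W`.
    · intro hb
      refine hWb ?_
      have hcomp : IsCompact (l '' W) := Metric.isCompact_of_isClosed_isBounded
        (isClosed_image_of_inverse hfc hU'o hlc hfl hWc hWU) hb
      refine (hcomp.image hfc).isBounded.subset fun u hu => ?_
      exact ⟨l u, ⟨u, hu, rfl⟩, hfl u (hWU hu)⟩
    · refine ⟨_, hW0, ?_⟩
      rw [Function.iterate_succ_apply']
      exact hlf _ (hDU (hC.iterate_mem_cycleDomain hB h hL (by omega) hB.zero_mem))

theorem IsTruncatedDomain.closure_cycleDomain_zero_subset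
    (hC : IsTruncatedDomain (expMap lam) z₀ B L₁ C)
    (hB : IsAbsorbingDomain (expMap lam) p z₀ B) (hlam : lam ≠ 0)
    (h : IsAttractingPeriodicPt (expMap lam) p z₀) (hp : 1 < p)
    (h0 : (0 : ℂ) ∈ basinComponent (expMap lam) p z₀ 1)
    (hL : ∀ b ∈ closure B, |((expMap lam)^[p - 1] b).im| < L₁) :
    closure (cycleDomain (expMap lam) p z₀ C 0) ⊆ basinComponent (expMap lam) p z₀ 0 := by
  refine Subset.trans ?_ (h.preimage_basinComponent_one hlam h0)
  refine Subset.trans ?_ (preimage_mono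
    (hC.cycleDomain_geometry hB hlam h hp h0 hL (j := 0) h.1).1)
  rw [hC.cycleDomain_zero hB hlam h hL]
  exact (continuous_expMap lam).closure_preimage_subset _

/-- Points of one component of the complement of `C_0` do not differ by a multiple of `2πi`. -/
theorem IsTruncatedDomain.eq_zero_of_translate_mem
    (hC : IsTruncatedDomain (expMap lam) z₀ B L₁ C)
    (hB : IsAbsorbingDomain (expMap lam) p z₀ B) (hlam : lam ≠ 0)
    (h : IsAttractingPeriodicPt (expMap lam) p z₀) (hp : 1 < p)
    (h0 : (0 : ℂ) ∈ basinComponent (expMap lam) p z₀ 1)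
    (hL : ∀ b ∈ closure B, |((expMap lam)^[p - 1] b).im| < L₁) {x y : ℂ} {s : ℤ}
    (hy : y ∈ connectedComponentIn (cycleDomain (expMap lam) p z₀ C 0)ᶜ x)
    (hys : y + 2 * Real.pi * Complex.I * s ∈
      connectedComponentIn (cycleDomain (expMap lam) p z₀ C 0)ᶜ x) : s = 0 := by
  obtain ⟨-, -, -, W, hWC, hWc, hWp, hWb, hW0⟩ :=
    hC.cycleDomain_geometry hB hlam h hp h0 hL (j := 0) h.1
  by_contra hs
  -- Passing to the open set `f⁻¹(Wᶜ)` makes components path connected. A loop in `Wᶜ` separating 0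
  -- from `∞` is impossible, since `W` joins them.
  have hmono : connectedComponentIn (cycleDomain (expMap lam) p z₀ C 0)ᶜ x ⊆
      connectedComponentIn (expMap lam ⁻¹' Wᶜ) x := by
    refine connectedComponentIn_mono x ?_
    rw [hC.cycleDomain_zero hB hlam h hL, ← preimage_compl]
    exact preimage_mono (compl_subset_compl.2 hWC)
  obtain ⟨Γ, hΓ, -, hbd⟩ :=
    exists_isCompact_of_translate_mem hWc.isOpen_compl hs (hmono hy) (hmono hys)
  exact hWb (hbd W hWp hW0 (disjoint_compl_left.mono_left hΓ))

/-- The components of the complement of `C_0` are translates of one another. -/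
theorem IsTruncatedDomain.exists_translate_mem
    (hC : IsTruncatedDomain (expMap lam) z₀ B L₁ C)
    (hB : IsAbsorbingDomain (expMap lam) p z₀ B) (hlam : lam ≠ 0)
    (h : IsAttractingPeriodicPt (expMap lam) p z₀) (hp : 1 < p)
    (h0 : (0 : ℂ) ∈ basinComponent (expMap lam) p z₀ 1)
    (hL : ∀ b ∈ closure B, |((expMap lam)^[p - 1] b).im| < L₁) {w x : ℂ}
    (hw : w ∉ cycleDomain (expMap lam) p z₀ C 0) (hx : x ∉ cycleDomain (expMap lam) p z₀ C 0) :
    ∃ s : ℤ, x + 2 * Real.pi * Complex.I * s ∈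
      connectedComponentIn (cycleDomain (expMap lam) p z₀ C 0)ᶜ w := by
  obtain ⟨-, hfp, hfn, W, hWC, hWc, hWp, hWb, hW0⟩ :=
    hC.cycleDomain_geometry hB hlam h hp h0 hL (j := 0) h.1
  have hK : IsPreconnected (cycleDomain (expMap lam) p z₀ C 1)ᶜ :=
    isPreconnected_compl_of_frontier (isOpen_cycleDomain hC.isOpen h.1) hfp hfn
  have hC0 := hC.cycleDomain_zero hB hlam h hL
  rw [hC0, mem_preimage] at hw hx
  rw [hC0, ← preimage_compl]
  set K := (cycleDomain (expMap lam) p z₀ C 1)ᶜ with hKdef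
  -- The inverse branch needs an open domain, so it is built on `G`, which contains the closed set
  -- `K`, and then restricted to `K`. Its image of `K` is connected and contains `w` and a translate
  -- of `x`.
  set G := connectedComponentIn Wᶜ (expMap lam w) with hG
  have hKG : K ⊆ G := hK.subset_connectedComponentIn hw (compl_subset_compl.2 hWC)
  have hGo : IsOpen G := hWc.isOpen_compl.connectedComponentIn
  have hGW : G ⊆ Wᶜ := connectedComponentIn_subset _ _
  obtain ⟨l, hlc, hl, hlf⟩ := exists_inverse_expMap hlam hGo isPreconnected_connectedComponentIn
    (fun hc => hGW hc hW0) (hKG hw) (fun y s hy hys => by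
      by_contra hs
      obtain ⟨Γ, hΓ, -, hbd⟩ := exists_isCompact_of_translate_mem hGo hs hy hys
      exact hWb (hbd W hWp hW0 (disjoint_compl_left.mono_left (hΓ.trans hGW))))
  obtain ⟨s, hs⟩ := (expMap_eq_expMap_iff hlam).1 (hl _ (hKG hx)).2
  refine ⟨s, ?_⟩
  rw [← hs]
  refine (hK.image l (hlc.mono hKG)).subset_connectedComponentIn
    ⟨_, hw, hlf w (mem_connectedComponentIn (hKG hw))⟩ ?_ ⟨_, hx, rfl⟩
  rintro _ ⟨u, hu, rfl⟩
  rwa [mem_preimage, (hl u (hKG hu)).2]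

end Domains

/-! ### The pieces and the points with itinerary in `Σ'_k` -/

/-- A segment from a point outside an open set to a point inside it first meets the closure of the
set at a point outside the set. -/
theorem exists_first_mem_closure {D : Set ℂ} (hD : IsOpen D) {a v : ℂ} (ha : a ∉ D)
    (h : ∃ t ∈ Icc (0 : ℝ) 1, a + t * v ∈ D) :
    ∃ t₀ ∈ Icc (0 : ℝ) 1, a + t₀ * v ∈ closure D ∧ ∀ t ∈ Icc 0 t₀, a + (t : ℝ) * v ∉ D := by
  have hg : Continuous fun t : ℝ => a + t * v := by fun_prop
  obtain ⟨t₁, ht₁, h₁⟩ := h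
  have hc : IsCompact (Icc (0 : ℝ) 1 ∩ (fun t : ℝ => a + t * v) ⁻¹' closure D) :=
    isCompact_Icc.inter_right (isClosed_closure.preimage hg)
  obtain ⟨t₀, ⟨ht₀, hcl⟩, hmin⟩ := hc.exists_isLeast ⟨t₁, ht₁, subset_closure h₁⟩
  refine ⟨t₀, ht₀, hcl, fun t ht htD => ?_⟩
  obtain ⟨ε, hε, hball⟩ := Metric.mem_nhds_iff.1 (hg.continuousAt.preimage_mem_nhds
    (hD.mem_nhds htD))
  rcases ht.1.eq_or_lt with rfl | hpos
  · exact ha (by simpa using htD)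
  set t' := max 0 (t - ε / 2) with ht'
  have h1 : t' < t := max_lt hpos (by linarith)
  have h2 : t' ∈ Metric.ball t ε := by
    rw [Metric.mem_ball, dist_comm, Real.dist_eq, abs_of_pos (by linarith)]
    linarith [le_max_right 0 (t - ε / 2)]
  have h3 := hmin ⟨⟨le_max_left _ _, by linarith [ht.2, ht₀.2]⟩, subset_closure (hball h2)⟩
  linarith [ht.2]

section Pieces

variable {lam : ℂ} {p : ℕ} {z₀ : ℂ} {B C : Set ℂ} {L₁ : ℝ}

theorem piece_subset (C₀ : Set ℂ) (w : ℂ) (s : ℤ) : piece C₀ w s ⊆ C₀ᶜ :=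
  connectedComponentIn_subset _ _

theorem IsPreconnected.subset_piece {C₀ : Set ℂ} {w : ℂ} {s : ℤ} {S : Set ℂ}
    (hS : IsPreconnected S) (hSC : S ⊆ C₀ᶜ) {x : ℂ} (hxS : x ∈ S) (hx : x ∈ piece C₀ w s) :
    S ⊆ piece C₀ w s := by
  rw [piece, connectedComponentIn_eq hx]
  exact hS.subset_connectedComponentIn hxS hSC

theorem IsTruncatedDomain.exists_mem_piece (hC : IsTruncatedDomain (expMap lam) z₀ B L₁ C)
    (hB : IsAbsorbingDomain (expMap lam) p z₀ B) (hlam : lam ≠ 0)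
    (h : IsAttractingPeriodicPt (expMap lam) p z₀) (hp : 1 < p)
    (h0 : (0 : ℂ) ∈ basinComponent (expMap lam) p z₀ 1)
    (hL : ∀ b ∈ closure B, |((expMap lam)^[p - 1] b).im| < L₁) {w x : ℂ}
    (hw : w ∉ cycleDomain (expMap lam) p z₀ C 0) (hx : x ∉ cycleDomain (expMap lam) p z₀ C 0) :
    ∃ s, x ∈ piece (cycleDomain (expMap lam) p z₀ C 0) w s := by
  obtain ⟨s, hs⟩ := hC.exists_translate_mem hB hlam h hp h0 hL hw hx
  refine ⟨-s, ?_⟩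
  have h1 := add_mem_connectedComponentIn (c := 2 * Real.pi * Complex.I * (-s : ℤ)) (by
    rw [hC.cycleDomain_zero hB hlam h hL, ← preimage_compl]
    exact add_mem_preimage_expMap (-s)) hs
  have h2 : x + 2 * Real.pi * Complex.I * s + 2 * Real.pi * Complex.I * (-s : ℤ) = x := by
    push_cast; ring
  rwa [h2] at h1

theorem IsTruncatedDomain.piece_unique (hC : IsTruncatedDomain (expMap lam) z₀ B L₁ C)
    (hB : IsAbsorbingDomain (expMap lam) p z₀ B) (hlam : lam ≠ 0)
    (h : IsAttractingPeriodicPt (expMap lam) p z₀) (hp : 1 < p)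
    (h0 : (0 : ℂ) ∈ basinComponent (expMap lam) p z₀ 1)
    (hL : ∀ b ∈ closure B, |((expMap lam)^[p - 1] b).im| < L₁) {w x : ℂ}
    (hw : w ∉ cycleDomain (expMap lam) p z₀ C 0) {s t : ℤ}
    (hs : x ∈ piece (cycleDomain (expMap lam) p z₀ C 0) w s)
    (ht : x ∈ piece (cycleDomain (expMap lam) p z₀ C 0) w t) : s = t := by
  have hmem : ∀ s : ℤ, w + 2 * Real.pi * Complex.I * s ∈
      (cycleDomain (expMap lam) p z₀ C 0)ᶜ := by
    intro s
    rw [hC.cycleDomain_zero hB hlam h hL] at hw ⊢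
    rw [← preimage_compl, mem_preimage, expMap_add_int]
    exact hw
  have h1 := mem_connectedComponentIn (hmem s)
  have h2 := mem_connectedComponentIn (hmem t)
  have h3 : w + 2 * Real.pi * Complex.I * t =
      w + 2 * Real.pi * Complex.I * s + 2 * Real.pi * Complex.I * (t - s : ℤ) := by
    push_cast; ring
  rw [connectedComponentIn_eq (show x ∈ connectedComponentIn _ _ from hs)] at h1
  rw [connectedComponentIn_eq (show x ∈ connectedComponentIn _ _ from ht), h3] at h2
  have := hC.eq_zero_of_translate_mem hB hlam h hp h0 hL h1 h2
  omega

/-- The part of the preimage of `U_{j+1}` in the piece of `U_j` is `U_j`. -/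
theorem IsTruncatedDomain.mem_basinComponent_of_piece
    (hC : IsTruncatedDomain (expMap lam) z₀ B L₁ C)
    (hB : IsAbsorbingDomain (expMap lam) p z₀ B) (hlam : lam ≠ 0)
    (h : IsAttractingPeriodicPt (expMap lam) p z₀) (hp : 1 < p)
    (h0 : (0 : ℂ) ∈ basinComponent (expMap lam) p z₀ 1)
    (hL : ∀ b ∈ closure B, |((expMap lam)^[p - 1] b).im| < L₁) {w : ℂ} {j : ℕ} (hj : 1 ≤ j)
    (hjp : j < p) {s : ℤ}
    (hs : basinComponent (expMap lam) p z₀ j ⊆ piece (cycleDomain (expMap lam) p z₀ C 0) w s)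
    {y : ℂ} (hy : y ∈ piece (cycleDomain (expMap lam) p z₀ C 0) w s)
    (hfy : expMap lam y ∈ basinComponent (expMap lam) p z₀ (j + 1)) :
    y ∈ basinComponent (expMap lam) p z₀ j := by
  -- The preimage `l (f y)` in `U_j` differs from `y` by a multiple of `2πi` and lies in the same
  -- piece, so the two coincide.
  obtain ⟨l, -, hl, -⟩ := h.exists_inverse_basinComponent hlam hp h0 hj hjp
  obtain ⟨hlU, hle⟩ := hl _ hfy
  obtain ⟨t, ht⟩ := (expMap_eq_expMap_iff hlam).1 hle
  have h1 := hs hlU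
  rw [ht] at h1
  have := hC.eq_zero_of_translate_mem hB hlam h hp h0 hL hy h1
  rw [this] at ht
  simp only [Int.cast_zero, mul_zero, add_zero] at ht
  rwa [ht] at hlU

/-- A compact forward invariant set with interior that contains the singular value and is covered by
the domains `C_1, …, C_p`. -/
theorem IsTruncatedDomain.exists_forward_invariant
    (hC : IsTruncatedDomain (expMap lam) z₀ B L₁ C)
    (hB : IsAbsorbingDomain (expMap lam) p z₀ B) (hlam : lam ≠ 0)
    (h : IsAttractingPeriodicPt (expMap lam) p z₀) (hp : 1 < p)
    (h0 : (0 : ℂ) ∈ basinComponent (expMap lam) p z₀ 1)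
    (hL : ∀ b ∈ closure B, |((expMap lam)^[p - 1] b).im| < L₁) :
    ∃ P : Set ℂ, IsCompact P ∧ MapsTo (expMap lam) P P ∧ (0 : ℂ) ∈ P ∧
      (∃ v, ∃ ρ > 0, Metric.ball v ρ ⊆ P) ∧
      P ⊆ ⋃ j : Fin p, cycleDomain (expMap lam) p z₀ C (j + 1) := by
  have hfc := continuous_expMap lam
  set f := expMap lam
  -- `f^p` maps `Y` into itself, so the union of its first `p` images is forward invariant. The
  -- point 0 is added because it need not lie in `f^p(closure B)`.
  set Y : Set ℂ := insert 0 (f^[p] '' closure B) with hY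
  have hYc : IsCompact Y := ((hB.isCompact_closure hlam h hp h0).image (hfc.iterate p)).insert 0
  have hYB : Y ⊆ B := by
    rintro y (rfl | ⟨b, hb, rfl⟩)
    · exact hB.zero_mem
    · exact hB.iterate_mem hb
  refine ⟨⋃ i ∈ Finset.range p, f^[i] '' Y, (Finset.range p).isCompact_biUnion fun i _ =>
    hYc.image (hfc.iterate i), ?_, ?_, ?_, ?_⟩
  · intro x hx
    simp only [mem_iUnion, Finset.mem_range] at hx ⊢
    obtain ⟨i, hi, y, hy, rfl⟩ := hx
    rw [← Function.iterate_succ_apply' f]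
    rcases Nat.lt_or_ge (i + 1) p with hlt | hge
    · exact ⟨i + 1, hlt, y, hy, rfl⟩
    · have hip : i.succ = p := by omega
      rw [hip]
      exact ⟨0, h.1, _, Or.inr ⟨y, subset_closure (hYB hy), rfl⟩, rfl⟩
  · simp only [mem_iUnion, Finset.mem_range]
    exact ⟨0, h.1, 0, Or.inl rfl, rfl⟩
  · have hopen : IsOpen (f^[p] '' B) := isOpenMap_iterate_expMap hlam p B hB.isOpen
    obtain ⟨ρ, hρ, hb⟩ := Metric.isOpen_iff.1 hopen _ ⟨0, hB.zero_mem, rfl⟩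
    refine ⟨_, ρ, hρ, hb.trans ?_⟩
    rintro _ ⟨b, hb, rfl⟩
    simp only [mem_iUnion, Finset.mem_range]
    exact ⟨0, h.1, _, Or.inr ⟨b, subset_closure hb, rfl⟩, rfl⟩
  · intro x hx
    simp only [mem_iUnion, Finset.mem_range] at hx ⊢
    obtain ⟨i, hi, y, hy, rfl⟩ := hx
    exact ⟨⟨i, hi⟩, hC.iterate_mem_cycleDomain hB h hL hi (hYB hy)⟩

/-- Julia points whose itinerary belongs to `Σ'_k` are boundary points of `U_0`. -/
theorem IsTruncatedDomain.mem_closure_of_hasItinerary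
    (hC : IsTruncatedDomain (expMap lam) z₀ B L₁ C)
    (hB : IsAbsorbingDomain (expMap lam) p z₀ B) (hlam : lam ≠ 0)
    (h : IsAttractingPeriodicPt (expMap lam) p z₀) (hp : 1 < p)
    (h0 : (0 : ℂ) ∈ basinComponent (expMap lam) p z₀ 1)
    (hL : ∀ b ∈ closure B, |((expMap lam)^[p - 1] b).im| < L₁) {w : ℂ}
    (hw : w ∉ cycleDomain (expMap lam) p z₀ C 0) {k : Fin (p - 1) → ℤ}
    (hk : ∀ i : Fin (p - 1), basinComponent (expMap lam) p z₀ (i + 1) ⊆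
      piece (cycleDomain (expMap lam) p z₀ C 0) w (k i))
    {z : ℂ} (hz : z ∈ juliaSet (expMap lam)) {σ : ℕ → ℤ}
    (hσ : HasItinerary (expMap lam) (piece (cycleDomain (expMap lam) p z₀ C 0) w) z σ)
    (hσk : σ ∈ kneadingSequences' p k) :
    z ∈ closure (basinComponent (expMap lam) p z₀ 0) := by
  have hf := differentiable_expMap lam
  have hfc := hf.continuous
  obtain ⟨P, hPc, hPm, hP0, ⟨v, ρ, hρ, hv⟩, hPV⟩ :=
    hC.exists_forward_invariant hB hlam h hp h0 hL
  set f := expMap lam with hfdef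
  set D₀ := cycleDomain f p z₀ C 0 with hD₀
  set V : Set ℂ := ⋃ j : Fin p, cycleDomain f p z₀ C (j + 1) with hV
  have hVo : IsOpen V := isOpen_iUnion fun j => isOpen_cycleDomain hC.isOpen j.2
  have hD₀o : IsOpen D₀ := isOpen_cycleDomain hC.isOpen (Nat.zero_le _)
  -- `r` is a uniform gap between `P` and the complement of `V`. `N` cuts a segment of length at
  -- most `2π` into steps shorter than `r / 2`. Both are fixed before the time `n` is chosen.
  obtain ⟨r, hr, hrV⟩ := hPc.exists_thickening_subset_open hVo hPV
  obtain ⟨N, hN⟩ := exists_nat_gt (4 * Real.pi / r)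
  have hNpos : (0 : ℝ) < N := lt_trans (by positivity) hN
  have hCD : C ⊆ D₀ := hC.subset_cycleDomain_zero hB hlam h hL
  have hA : MapsTo f (D₀ ∪ V) (D₀ ∪ V) := by
    have h1 : MapsTo f D₀ V := fun x hx =>
      mem_iUnion.2 ⟨⟨0, h.1⟩, mapsTo_cycleDomain h.1 hx⟩
    rintro x (hx | hx)
    · exact Or.inr (h1 hx)
    · obtain ⟨j, hj⟩ := mem_iUnion.1 hx
      rcases Nat.lt_or_ge (j + 1) p with hlt | hge
      · exact Or.inr (mem_iUnion.2 ⟨⟨j + 1, hlt⟩, mapsTo_cycleDomain hlt hj⟩)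
      · have hjp : (j : ℕ) + 1 = p := by have := j.2; omega
        rw [hjp, cycleDomain_period] at hj
        exact Or.inr (h1 (hCD hj))
  rw [Metric.mem_closure_iff]
  intro ε hε
  obtain ⟨m₀, hm₀⟩ := inverse_branch_shrinks_chain hf hPm hρ hv hz r N hε
  obtain ⟨l, hl, hlm⟩ := (hσk.2.and_eventually (eventually_ge_atTop m₀)).exists
  set n := p * l with hn
  have hnm : n ≥ m₀ := hlm.trans (Nat.le_mul_of_pos_left l h.1)
  set ζ := f^[n] z with hζ
  have hζH : ζ ∈ piece D₀ w (σ n) := hσ n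
  have hζD : ζ ∉ D₀ := piece_subset _ _ _ hζH
  set τ : ℂ := 2 * Real.pi * Complex.I with hτ
  have hτn : ‖τ‖ = 2 * Real.pi := by
    simp [hτ, abs_of_pos Real.pi_pos]
  -- The segment from `ζ` to its translate `ζ + 2πi` meets `C_0`: otherwise both endpoints would lie
  -- in one piece.
  obtain ⟨t₀, ht₀, hecl, hout⟩ := exists_first_mem_closure hD₀o (v := τ) hζD (by
    by_contra! hcon
    have hsub : segment ℝ ζ (ζ + τ) ⊆ D₀ᶜ := by
      rw [segment_eq_image']
      rintro _ ⟨t, ht, rfl⟩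
      have := hcon t ht
      simpa using this
    have h1 := (convex_segment ζ (ζ + τ)).isPreconnected.subset_connectedComponentIn
      (left_mem_segment ℝ _ _) hsub
    have h2 := h1 (right_mem_segment ℝ _ _)
    have h3 := hC.eq_zero_of_translate_mem hB hlam h hp h0 hL (x := ζ) (y := ζ) (s := 1)
      (h1 (left_mem_segment ℝ _ _)) (by simpa [hτ] using h2)
    exact one_ne_zero h3)
  set e : ℂ := ζ + t₀ * τ with he
  have heU : e ∈ basinComponent f p z₀ 0 :=
    hC.closure_cycleDomain_zero_subset hB hlam h hp h0 hL hecl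
  set S := segment ℝ ζ e with hS
  have hSmem : ∀ t ∈ Icc (0 : ℝ) 1, ζ + (t * t₀ : ℝ) * τ ∈ S := by
    intro t ht
    rw [hS, segment_eq_image']
    refine ⟨t, ht, ?_⟩
    simp [he, mul_assoc]
  have hSD : S ⊆ D₀ᶜ := by
    rw [hS, segment_eq_image']
    rintro _ ⟨t, ht, rfl⟩
    have := hout (t * t₀) ⟨mul_nonneg ht.1 ht₀.1, mul_le_of_le_one_left ht₀.1 ht.2⟩
    simpa [he, mul_assoc] using this
  have hζS : ζ ∈ S := left_mem_segment ℝ _ _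
  have heS : e ∈ S := right_mem_segment ℝ _ _
  have hSpre : IsPreconnected S := (convex_segment ζ e).isPreconnected
  have hSH : S ⊆ piece D₀ w (σ n) := hSpre.subset_piece hSD hζS hζH
  -- `C_p` lies in `C_0`, and every other `C_j` lies in the piece with label `k_j`, which differs
  -- from that of `S` by the choice of `l`.
  have hSA : ∀ x ∈ S, x ∉ D₀ ∪ V := by
    rintro x hx (hxD | hxV)
    · exact hSD hx hxD
    · obtain ⟨j, hj⟩ := mem_iUnion.1 hxV
      rcases Nat.lt_or_ge (j + 1) p with hlt | hge
      · refine hl ⟨⟨j, by omega⟩, ?_⟩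
        refine hC.piece_unique hB hlam h hp h0 hL hw (hk ⟨j, by omega⟩ ?_) (hSH hx)
        exact hC.cycleDomain_subset hB h hlt.le hj
      · have hjp : (j : ℕ) + 1 = p := by have := j.2; omega
        rw [hjp, cycleDomain_period] at hj
        exact hSD hx (hCD hj)
  have hdisj : Disjoint (Metric.thickening r S) P := by
    rw [disjoint_left]
    intro x hx hxP
    obtain ⟨y, hy, hxy⟩ := Metric.mem_thickening_iff.1 hx
    refine hSA y hy (Or.inr (hrV (Metric.mem_thickening_iff.2 ⟨x, hxP, ?_⟩)))
    rwa [dist_comm]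
  have hNo : IsOpen (Metric.thickening r S) := Metric.isOpen_thickening
  have hST : S ⊆ Metric.thickening r S := Metric.self_subset_thickening hr S
  have hsc : IsSimplyConnected (Metric.thickening r S) := by
    have := ((convex_segment ζ e).thickening r).contractibleSpace ⟨ζ, hST hζS⟩
    exact (inferInstance : SimplyConnectedSpace (Metric.thickening r S))
  obtain ⟨φ, hφc, hφ, hφz⟩ := exists_inverse_branch hlam hPm hP0 hNo hsc hdisj n z (hST hζS)
  have hφd := differentiableOn_of_inverse_branch hlam hNo hφc hφ
  -- `D₀ ∪ V` is forward invariant and `S` avoids it, so the pulled back segments avoid `C_0` and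
  -- each stays in the piece of the corresponding iterate of `z`.
  have hitin : ∀ i ≤ n, f^[i] (φ e) ∈ piece D₀ w (σ i) := by
    intro i hi
    have hpre : IsPreconnected ((fun x => f^[i] (φ x)) '' S) :=
      hSpre.image _ ((hfc.iterate i).comp_continuousOn (hφc.mono hST))
    refine hpre.subset_piece ?_ ⟨ζ, hζS, rfl⟩ ?_ ⟨e, heS, rfl⟩
    · rintro _ ⟨x, hx, rfl⟩ hxD
      have h1 := hA.iterate (n - i) (Or.inl hxD)
      rw [← Function.iterate_add_apply, Nat.sub_add_cancel hi, hφ x (hST hx)] at h1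
      exact hSA x hx h1
    · simp only [hζ]
      rw [hφz]
      exact hσ i
  -- Backwards from `e ∈ U_0`: at multiples of `p` every preimage of `U_1` is in `U_0`; at other
  -- times the prescribed piece `H_{k_j}` selects `U_j` among the preimages of `U_{j+1}`.
  have hback : ∀ i ≤ n, f^[i] (φ e) ∈ basinComponent f p z₀ (i % p) := by
    intro i hi
    induction hi using Nat.decreasingInduction with
    | self =>
      rw [hφ e (hST heS), hn, Nat.mul_mod_right]
      exact heU
    | of_succ i hi ih =>
      rw [Function.iterate_succ_apply'] at ih
      rcases Nat.eq_zero_or_pos (i % p) with hi0 | hi0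
      · rw [Nat.add_mod, hi0, zero_add, Nat.mod_mod, Nat.mod_eq_of_lt hp] at ih
        rw [hi0]
        exact h.preimage_basinComponent_one hlam h0 ih
      · have hlt := Nat.mod_lt i h.1
        have hdm := Nat.div_add_mod i p
        have hsucc : basinComponent f p z₀ ((i + 1) % p) =
            basinComponent f p z₀ (i % p + 1) := by
          rcases Nat.lt_or_ge (i % p + 1) p with h1 | h1
          · rw [Nat.add_mod, Nat.mod_eq_of_lt hp, Nat.mod_eq_of_lt h1]
          · have h2 : i % p + 1 = p := by omega
            rw [Nat.add_mod, Nat.mod_eq_of_lt hp, h2, Nat.mod_self, h.basinComponent_period]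
        rw [hsucc] at ih
        have hσi := hσk.1 (i / p) ⟨i % p - 1, by omega⟩
        have h3 : p * (i / p) + (i % p - 1 + 1) = i := by omega
        simp only [h3] at hσi
        have hk' := hk ⟨i % p - 1, by omega⟩
        simp only [Nat.sub_add_cancel hi0] at hk'
        have hmem := hitin i hi.le
        rw [hσi] at hmem
        exact hC.mem_basinComponent_of_piece hB hlam h hp h0 hL hi0 hlt hk' hmem ih
  refine ⟨φ e, by simpa using hback 0 (Nat.zero_le _), ?_⟩
  -- Discs of radius `r` about the `N + 1` equally spaced points of `S` form the chain that carries
  -- closeness to `z` from `φ ζ` to `φ e`.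
  have hpts : ∀ i ≤ N, Metric.ball (ζ + i * (t₀ / N * τ)) r ⊆ Metric.thickening r S := by
    intro i hi
    refine Metric.ball_subset_thickening ?_ r
    have h1 := hSmem (i / N) ⟨by positivity, (div_le_one hNpos).2 (by exact_mod_cast hi)⟩
    convert h1 using 2
    push_cast; ring
  have hend : ζ + N * (t₀ / N * τ) = e := by
    have : (N : ℂ) ≠ 0 := by exact_mod_cast hNpos.ne'
    rw [he]; field_simp
  rw [dist_comm, dist_eq_norm, ← hend]
  refine hm₀ n hnm ζ (t₀ / N * τ) φ ?_ (fun i hi => hφd.mono (hpts i hi))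
    (fun i hi u hu => hφ u (hpts i hi hu)) (fun i hi => hdisj.mono_left (hpts i hi)) hφz
  rw [norm_mul, norm_div, hτn, Complex.norm_real, Complex.norm_natCast, Real.norm_eq_abs,
    abs_of_nonneg ht₀.1]
  have h1 : t₀ / N * (2 * Real.pi) ≤ 1 / N * (2 * Real.pi) := by
    have := Real.pi_pos
    gcongr
    exact ht₀.2
  rw [div_lt_iff₀ hr] at hN
  have h2 : 1 / N * (2 * Real.pi) < r / 2 := by
    rw [div_mul_eq_mul_div, div_lt_iff₀ hNpos]
    linarith
  linarith

end Pieces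

/-! ### Assembly of the theorem -/

theorem mainTheorem6 (lam : ℂ) (hlam : lam ≠ 0) (p : ℕ) (hp : 1 < p) (z₀ : ℂ)
    (hz₀ : IsAttractingPeriodicPt (expMap lam) p z₀)
    (h0 : (0 : ℂ) ∈ basinComponent (expMap lam) p z₀ 1)
    (B : Set ℂ) (hB : IsAbsorbingDomain (expMap lam) p z₀ B) :
    ∃ L₀ : ℝ, ∀ L₁ : ℝ, L₀ ≤ L₁ →
      ∀ C : Set ℂ, IsTruncatedDomain (expMap lam) z₀ B L₁ C →
      ∀ w : ℂ, w ∉ cycleDomain (expMap lam) p z₀ C 0 →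
      ∀ H : ℤ → Set ℂ, H = piece (cycleDomain (expMap lam) p z₀ C 0) w →
        (∀ z ∈ juliaSet (expMap lam), ∃! σ : ℕ → ℤ, HasItinerary (expMap lam) H z σ) ∧
        ∃ k : Fin (p - 1) → ℤ,
          IsKneadingBlock (expMap lam) p z₀ C H k ∧
          (∀ k' : Fin (p - 1) → ℤ, IsKneadingBlock (expMap lam) p z₀ C H k' → k' = k) ∧
          {z | z ∈ juliaSet (expMap lam) ∧
              ∃ σ ∈ kneadingSequences' p k, HasItinerary (expMap lam) H z σ}
            ⊆ frontier (basinComponent (expMap lam) p z₀ 0) ∧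
          frontier (basinComponent (expMap lam) p z₀ 0) ⊆
            {z | z ∈ juliaSet (expMap lam) ∧
              ∃ σ ∈ kneadingSequences p k, HasItinerary (expMap lam) H z σ} := by
  have hf := differentiable_expMap lam
  have hfc := hf.continuous
  obtain ⟨R, hR⟩ := (Metric.isBounded_iff_subset_closedBall 0).1
    ((hB.isCompact_closure hlam hz₀ hp h0).image (hfc.iterate (p - 1))).isBounded
  -- `R` bounds `f^{p-1}(closure B)`; adding 1 makes the bound on imaginary parts strict.
  refine ⟨R + 1, fun L₁ hL₁ C hC w hw H hH => ?_⟩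
  have hL : ∀ b ∈ closure B, |((expMap lam)^[p - 1] b).im| < L₁ := by
    intro b hb
    have h1 := hR ⟨b, hb, rfl⟩
    rw [mem_closedBall_zero_iff] at h1
    linarith [Complex.abs_im_le_norm ((expMap lam)^[p - 1] b)]
  subst hH
  have hD₀o : IsOpen (cycleDomain (expMap lam) p z₀ C 0) :=
    isOpen_cycleDomain hC.isOpen (Nat.zero_le _)
  have hcover := fun x hx => hC.exists_mem_piece hB hlam hz₀ hp h0 hL (x := x) hw hx
  have huniq := fun {x : ℂ} {s t : ℤ} hs ht =>
    hC.piece_unique hB hlam hz₀ hp h0 hL (x := x) (s := s) (t := t) hw hs ht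
  have hD₀U := hC.cycleDomain_subset hB hz₀ (Nat.zero_le p)
  have hJ : ∀ z ∈ juliaSet (expMap lam), ∀ n,
      (expMap lam)^[n] z ∉ cycleDomain (expMap lam) p z₀ C 0 := fun z hz n hn =>
    hz (hz₀.cycleBasin_subset_fatouSet hf ((hz₀.iterate_mem_cycleBasin_iff hfc n).1
      (basinComponent_subset_cycleBasin 0 (hD₀U hn))))
  have hitin : ∀ z ∈ juliaSet (expMap lam), ∃ σ,
      HasItinerary (expMap lam) (piece (cycleDomain (expMap lam) p z₀ C 0) w) z σ := by
    intro z hz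
    choose σ hσ using fun n => hcover _ (hJ z hz n)
    exact ⟨σ, hσ⟩
  have hUD : ∀ j, 1 ≤ j → j < p →
      basinComponent (expMap lam) p z₀ j ⊆ (cycleDomain (expMap lam) p z₀ C 0)ᶜ :=
    fun j hj hjp x hx hxD =>
      disjoint_left.1 (hz₀.disjoint_basinComponent hf hjp hz₀.1 (by omega)) hx (hD₀U hxD)
  have hpiece : ∀ i : Fin (p - 1), ∃ s,
      basinComponent (expMap lam) p z₀ (i + 1) ⊆
        piece (cycleDomain (expMap lam) p z₀ C 0) w s := by
    intro i
    have hi := i.2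
    have hUi := hUD (i + 1) (by omega) (by omega)
    have hmem := hz₀.mem_basinComponent hfc (i + 1)
    obtain ⟨s, hs⟩ := hcover _ (hUi hmem)
    exact ⟨s, (isPreconnected_basinComponent _).subset_piece hUi hmem hs⟩
  choose k hk using hpiece
  refine ⟨fun z hz => ?_, k, fun i => ?_, fun k' hk' => ?_, ?_, ?_⟩
  · obtain ⟨σ, hσ⟩ := hitin z hz
    exact ⟨σ, hσ, fun τ hτ => funext fun n => huniq (hτ n) (hσ n)⟩
  · have hi := i.2
    exact ⟨mem_cycleDomain hz₀ hC.cycle_mem (by omega),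
      hC.cycleDomain_subset hB hz₀ (by omega), hk i⟩
  · funext i
    have hmem := hz₀.mem_basinComponent hfc (i + 1)
    exact huniq ((hk' i).2.2 hmem) (hk i hmem)
  · rintro z ⟨hz, σ, hσk, hσ⟩
    rw [(hz₀.isOpen_basinComponent hf 0).frontier_eq]
    refine ⟨hC.mem_closure_of_hasItinerary hB hlam hz₀ hp h0 hL hw hk hz hσ hσk, fun hzU => ?_⟩
    exact hz (hz₀.cycleBasin_subset_fatouSet hf (basinComponent_subset_cycleBasin 0 hzU))
  · intro z hz
    have hzJ := hz₀.frontier_basinComponent_subset_juliaSet hf hz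
    obtain ⟨σ, hσ⟩ := hitin z hzJ
    refine ⟨hzJ, σ, fun l i => ?_, hσ⟩
    -- By continuity the orbit of a boundary point stays in the closures of the `U_j`; the pieces
    -- are closed, so the closure of `U_j` remains in the piece of `U_j`.
    have hcl : ∀ n, (expMap lam)^[n] z ∈ closure (basinComponent (expMap lam) p z₀ (n % p)) := by
      intro n
      induction n with
      | zero => simpa using frontier_subset_closure hz
      | succ n ih =>
        rw [Function.iterate_succ_apply']
        have h1 := (hz₀.mapsTo_basinComponent hfc (n % p)).closure hfc ih
        rcases Nat.lt_or_ge (n % p + 1) p with h2 | h2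
        · rwa [Nat.add_mod, Nat.mod_eq_of_lt hp, Nat.mod_eq_of_lt h2]
        · have h3 : n % p + 1 = p := by have := Nat.mod_lt n hz₀.1; omega
          rw [h3, hz₀.basinComponent_period] at h1
          rwa [Nat.add_mod, Nat.mod_eq_of_lt hp, h3, Nat.mod_self]
    have hi := i.2
    have h1 := hcl (p * l + (i + 1))
    rw [Nat.mul_add_mod, Nat.mod_eq_of_lt (by omega)] at h1
    refine huniq (hσ _) ?_
    exact closure_minimal (hk i) (isClosed_connectedComponentIn hD₀o.isClosed_compl _) h1
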